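/- **Setting.** Fix the number of layers $L\ge 1$ and a message passing neural network, given by update functions $U_l$ and message functions $M_{liu}$ ($l=1,\dots,L$; the latter may depend on the input graph and on the nodes $i,u$). For a graph on the nodes $\{1,\dots,n\}$ (directed edges and self-loops are allowed; undirected graphs are the symmetric case), node features $\boldsymbol x_i$, edge features $\boldsymbol e_{iu}$ and parameters $\boldsymbol\theta$, the exact embeddings are $\boldsymbol z_i^{(0)}=\boldsymbol x_i$, $$\boldsymbol h_i^{(l)}=\sum_{u\in\mathcal N(i)}M_{liu}(\boldsymbol z_i^{(l-1)},\boldsymbol z_u^{(l-1)},\boldsymbol e_{iu},\boldsymbol\theta),\qquad \boldsymbol z_i^{(l)}=U_l(\boldsymbol z_i^{(l-1)},\boldsymbol h_i^{(l)},\boldsymbol\theta).$$ Neighbor sampling with $r^{(1)},\dots,r^{(L)}$ samples estimates $\boldsymbol z_v^{(l)}$ recursively: for $l=0$ it returns $\boldsymbol x_v$; for $l\ge1$ it computes an estimate $\hat{\boldsymbol z}_v^{(l-1)}$, draws a multiset $\mathcal S$ of $r^{(l)}$ neighbors of $v$ uniformly with replacement, computes a fresh estimate $\hat{\boldsymbol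 z}_u^{(l-1)}$ for each $u\in\mathcal S$, and returns $\hat{\boldsymbol z}_v^{(l)}=U_l(\hat{\boldsymbol z}_v^{(l-1)},\hat{\boldsymbol h}_v^{(l)},\boldsymbol\theta)$ with $$\hat{\boldsymbol h}_v^{(l)}=\frac{\deg(v)}{r^{(l)}}\sum_{u\in\mathcal S}M_{lvu}(\hat{\boldsymbol z}_v^{(l-1)},\hat{\boldsymbol z}_u^{(l-1)},\boldsymbol e_{vu},\boldsymbol\theta)$$ (and $\hat{\boldsymbol h}_v^{(l)}=0$ if $\deg(v)=0$). The estimate of $\partial\boldsymbol z_v^{(L)}/\partial\boldsymbol\theta$ is the gradient $\partial\hat{\boldsymbol z}_v^{(L)}/\partial\boldsymbol\theta$ of the estimate with the samples kept fixed; it is computed along with $\hat{\boldsymbol z}_v^{(L)}$ by the chain rule. Time counts one unit for each oracle query (degree, $i$-th neighbor, node feature, edge feature, message function), each random draw, each evaluation of a message or update function or of its Jacobian, and each addition or rescaling of vectors or Jacobians. **Assumptions**, with constants that do not depend on the input: (1) $\|\boldsymbol x_i\|_2\le B$, $\|\boldsymbol e_{iu}\|_2\le B$ and $\|\boldsymbol\theta\|_2\le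 B$; (4) on every bounded domain the functions $\deg(i)M_{liu}$ ($u\in\mathcal N(i)$) and $U_l$ are Lipschitz, with a constant $K$ that depends only on the domain, and $\|\deg(i)M_{liu}(0)\|_2\le C_0$; (5) the functions $M_{liu}$ ($u\in\mathcal N(i)$) and $U_l$ are differentiable, and on every bounded domain $\deg(i)\,DM_{liu}$ and $DU_l$ are Lipschitz, with a constant $K'$ that depends only on the domain. **Theorem.** There are sample sizes $r^{(l)}(\varepsilon,\delta)\ge 1$ ($1\le l\le L$, $\varepsilon>0$, $0<\delta<1$), which depend on the network, $L$, $B$, $C_0$, $K$, $K'$ but not on the input, such that for all $\varepsilon>0$ and $0<\delta<1$, all inputs satisfying Assumptions 1, 4 and 5 with these constants, and all nodes $v$, the gradients of $\boldsymbol z_v^{(L)}$ and $\hat{\boldsymbol z}_v^{(L)}$ with respect to the parameters exist at $\boldsymbol\theta$, and $$\Pr\Bigl[\Bigl\|\frac{\partial\hat{\boldsymbol z}_v^{(L)}}{\partial\boldsymbol\theta}-\frac{\partial\boldsymbol z_v^{(L)}}{\partial\boldsymbol\theta}\Bigr\|_F\ge\varepsilon\Bigr]\le\delta .$$ Moreover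 $$r^{(L)}=O\Bigl(\frac1{\varepsilon^2}\log\frac1\delta\Bigr),\qquad r^{(1)},\dots,r^{(L-1)}=O\Bigl(\frac1{\varepsilon^2}\bigl(\log\tfrac1\varepsilon+\log\tfrac1\delta\bigr)\Bigr),$$ and the running time (in the worst case over the random draws, the input graph and the node) is $$O\Bigl(\frac1{\varepsilon^{2L}}\bigl(\log\tfrac1\varepsilon+\log\tfrac1\delta\bigr)^{L-1}\log\tfrac1\delta\Bigr).$$ The $O$-bounds hold for $0<\varepsilon\le\varepsilon_0$ and $0<\delta\le\delta_0$, for any fixed $\varepsilon_0,\delta_0<1$; the hidden constants depend on $\varepsilon_0$, $\delta_0$, the network, $L$, $B$, $C_0$, $K$, $K'$ but not on the input. -/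

import Mathlib

open scoped NNReal

noncomputable section

/-- `ℝ^d` with the Euclidean norm. -/
abbrev Vec (d : ℕ) : Type := EuclideanSpace ℝ (Fin d)

/-- The set `N(v)` of neighbors of `v`. Graphs may be directed and may have self-loops; undirected
graphs are the symmetric ones. -/
def neighbors {n : ℕ} (G : Digraph (Fin n)) (v : Fin n) : Finset (Fin n) :=
  open scoped Classical in Finset.univ.filter (fun u => G.Adj v u)

/-- The degree `deg(v) = |N(v)|`. -/
def deg {n : ℕ} (G : Digraph (Fin n)) (v : Fin n) : ℕ := (neighbors G v).card

/-- The structure of a message passing neural network. Index `l` of `msg` and `upd` belongs to layer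
`l + 1`, which maps embeddings in `ℝ^(dz l)` to embeddings in `ℝ^(dz (l + 1))`.
The message function `M_{l+1,i,u}` may depend on the graph and on the nodes `i` and `u`
(for example through their degrees). -/
structure MPNN where
  /-- number of parameters -/
  p : ℕ
  /-- dimension of the edge features -/
  de : ℕ
  /-- dimensions of the embeddings; `dz 0` is the dimension of the node features -/
  dz : ℕ → ℕ
  /-- dimensions of the messages -/
  dh : ℕ → ℕ
  /-- message functions, applied to `(z_i, z_u, e_iu, θ)` -/
  msg : {n : ℕ} → Digraph (Fin n) → (l : ℕ) → Fin n → Fin n →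
    Vec (dz l) × Vec (dz l) × Vec de × Vec p → Vec (dh l)
  /-- update functions, applied to `(z_i, h_i, θ)` -/
  upd : (l : ℕ) → Vec (dz l) × Vec (dh l) × Vec p → Vec (dz (l + 1))

namespace MPNN

/-- Parameter vectors. -/
abbrev Par (A : MPNN) : Type := Vec A.p

/-- Node embeddings after `l` layers. -/
abbrev Emb (A : MPNN) (l : ℕ) : Type := Vec (A.dz l)

/-- Aggregated messages of layer `l + 1`. -/
abbrev Agg (A : MPNN) (l : ℕ) : Type := Vec (A.dh l)

/-- Arguments of the message functions of layer `l + 1`. -/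
abbrev MsgArg (A : MPNN) (l : ℕ) : Type := A.Emb l × A.Emb l × Vec A.de × A.Par

/-- An input: a graph with node features, edge features and model parameters. -/
structure Input (A : MPNN) where
  n : ℕ
  G : Digraph (Fin n)
  x : Fin n → A.Emb 0
  e : Fin n → Fin n → Vec A.de
  θ : A.Par

/-- The exact embedding `z_i^(l)`, as a function of the parameters (the field `θ` is not used). -/
def Input.embed {A : MPNN} (I : A.Input) : (l : ℕ) → Fin I.n → A.Par → A.Emb l
  | 0, i, _ => I.x i
  | l + 1, i, t =>
    A.upd l (I.embed l i t,
      ∑ u ∈ neighbors I.G i, A.msg I.G l i u (I.embed l i t, I.embed l u t, I.e i u, t), t)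

/-! ### Assumptions -/

/-- Node features, edge features and parameters are bounded by `B`. -/
structure Input.BoundedBy {A : MPNN} (I : A.Input) (B : ℝ) : Prop where
  feature : ∀ i, ‖I.x i‖ ≤ B
  edge : ∀ i, ∀ u ∈ neighbors I.G i, ‖I.e i u‖ ≤ B
  param : ‖I.θ‖ ≤ B

/-- `f` is Lipschitz on every bounded domain: with constant `K R` on the ball of radius `R`. -/
def LipschitzOnBounded {E F : Type} [SeminormedAddCommGroup E] [SeminormedAddCommGroup F]
    (K : ℝ → ℝ≥0) (f : E → F) : Prop :=
  ∀ R : ℝ, LipschitzOnWith (K R) f (Metric.closedBall 0 R)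

/-- The update functions of the first `L` layers are Lipschitz on bounded domains. -/
def LipschitzUpd (A : MPNN) (L : ℕ) (K : ℝ → ℝ≥0) : Prop :=
  ∀ l < L, LipschitzOnBounded K (A.upd l)

/-- The update functions of the first `L` layers are differentiable, and their Jacobians are
Lipschitz on bounded domains. -/
def LipschitzJacUpd (A : MPNN) (L : ℕ) (K' : ℝ → ℝ≥0) : Prop :=
  ∀ l < L, Differentiable ℝ (A.upd l) ∧ LipschitzOnBounded K' (fderiv ℝ (A.upd l))

/-- On the edges of `G`, the functions `deg(i) M_{liu}` of the first `L` layers are Lipschitz on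
bounded domains, and their values at the origin are bounded by `C₀`. -/
def LipschitzMsg (A : MPNN) {n : ℕ} (G : Digraph (Fin n)) (L : ℕ) (K : ℝ → ℝ≥0) (C₀ : ℝ) : Prop :=
  ∀ l < L, ∀ i, ∀ u ∈ neighbors G i,
    LipschitzOnBounded K (fun q => (deg G i : ℝ) • A.msg G l i u q) ∧
    ‖(deg G i : ℝ) • A.msg G l i u 0‖ ≤ C₀

/-- On the edges of `G`, the functions `M_{liu}` of the first `L` layers are differentiable, and
`deg(i) D M_{liu}` is Lipschitz on bounded domains. -/
def LipschitzJacMsg (A : MPNN) {n : ℕ} (G : Digraph (Fin n)) (L : ℕ) (K' : ℝ → ℝ≥0) : Prop :=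
  ∀ l < L, ∀ i, ∀ u ∈ neighbors G i,
    Differentiable ℝ (A.msg G l i u) ∧
    LipschitzOnBounded K' (fun q => (deg G i : ℝ) • fderiv ℝ (A.msg G l i u) q)

/-! ### Randomized oracle machines -/

/-- Oracle queries about an input with `n` nodes. -/
inductive Query (A : MPNN) (n : ℕ) : Type
  /-- the degree of a node -/
  | degree (v : Fin n)
  /-- the `i`-th neighbor of a node, counted from `0` -/
  | neighbor (v : Fin n) (i : ℕ)
  /-- the feature of a node -/
  | feature (v : Fin n)
  /-- the feature of an edge -/
  | edge (v u : Fin n)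
  /-- the message function of layer `l + 1` for an edge -/
  | message (l : ℕ) (v u : Fin n)

/-- The type of the answer to a query. -/
def Query.Answer {A : MPNN} {n : ℕ} : A.Query n → Type
  | .degree _ => ℕ
  | .neighbor _ _ => Fin n
  | .feature _ => A.Emb 0
  | .edge _ _ => Vec A.de
  | .message l _ _ => A.MsgArg l → A.Agg l

/-- The answers of the oracles for the input `I`. An index `i` that is not below the degree of `v`
is answered by `v`. -/
def Input.answer {A : MPNN} (I : A.Input) : (q : A.Query I.n) → q.Answer
  | .degree v => deg I.G v
  | .neighbor v i =>
    if h : i < deg I.G v then (neighbors I.G v).orderEmbOfFin rfl ⟨i, h⟩ else v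
  | .feature v => I.x v
  | .edge v u => I.e v u
  | .message l v u => A.msg I.G l v u

/-- Randomized oracle programs with result in `α`: they can return a result, query an oracle,
draw a uniformly random element of `{0, …, N}`, or spend `c` units of time on computation. -/
inductive Prog (A : MPNN) (n : ℕ) (α : Type) : Type
  | ret (a : α)
  | ask (q : A.Query n) (k : q.Answer → Prog A n α)
  | sample (N : ℕ) (k : Fin (N + 1) → Prog A n α)
  | spend (c : ℕ) (k : Prog A n α)

namespace Prog

variable {A : MPNN} {n : ℕ} {α β : Type}

/-- Sequential composition. -/
def bind : A.Prog n α → (α → A.Prog n β) → A.Prog n β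
  | ret a, f => f a
  | ask q k, f => ask q (fun a => bind (k a) f)
  | sample N k, f => sample N (fun i => bind (k i) f)
  | spend c k, f => spend c (bind k f)

instance : Monad (A.Prog n) where
  pure := ret
  bind := bind

/-- Ask one query. -/
def query (q : A.Query n) : A.Prog n q.Answer := ask q ret

/-- Draw a uniformly random element of `{0, …, N}`. -/
def uniform (N : ℕ) : A.Prog n (Fin (N + 1)) := sample N ret

/-- Spend `c` units of time. -/
def tick (c : ℕ) : A.Prog n Unit := spend c (ret ())

/-- The sum of the results of `r` independent executions of a program; every addition costs one
unit of time. -/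
def sum [Zero α] [Add α] (P : A.Prog n α) : ℕ → A.Prog n α
  | 0 => pure 0
  | r + 1 => do
    let s ← sum P r
    let a ← P
    tick 1
    return s + a

/-- Execution on the input `I`: the joint distribution of the result and of the running time. Every
query and every random draw costs one unit of time. -/
def run (I : A.Input) : A.Prog I.n α → PMF (α × ℕ)
  | ret a => PMF.pure (a, 0)
  | ask q k => (run I (k (I.answer q))).map (fun o => (o.1, o.2 + 1))
  | sample N k =>
    (PMF.uniformOfFintype (Fin (N + 1))).bind
      (fun i => (run I (k i)).map (fun o => (o.1, o.2 + 1)))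
  | spend c k => (run I k).map (fun o => (o.1, o.2 + c))

end Prog

/-! ### Neighbor sampling -/

/-- What neighbor sampling computes for a quantity with values in `E`: the value of its estimate at
the given parameters, the Jacobian of the estimate with respect to the parameters, and (as a record
of what has been computed) the estimate as a function of the parameters, all random samples being
kept fixed. The record takes no part in the computation of the other two. -/
abbrev Estimate (A : MPNN) (E : Type) [NormedAddCommGroup E] [NormedSpace ℝ E] : Type :=
  E × (A.Par →L[ℝ] E) × (A.Par → E)

/-- Sample one of the `N + 1` neighbors of `v`, estimate its embedding by `est`, and compute the
message from it to `v`, given the estimate `z` for `v`. Evaluating the message function and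
evaluating and propagating its Jacobian cost one unit of time each. -/
def sampleMessage (A : MPNN) {n : ℕ} (θ : A.Par) (l : ℕ)
    (est : Fin n → A.Prog n (A.Estimate (A.Emb l)))
    (v : Fin n) (z : A.Estimate (A.Emb l)) (N : ℕ) : A.Prog n (A.Estimate (A.Agg l)) := do
  let i ← Prog.uniform N
  let u : Fin n ← Prog.query (.neighbor v i)
  let w ← est u
  let e : Vec A.de ← Prog.query (.edge v u)
  let M : A.MsgArg l → A.Agg l ← Prog.query (.message l v u)
  Prog.tick 2
  return (M (z.1, w.1, e, θ),
    (fderiv ℝ M (z.1, w.1, e, θ)).comp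
      (z.2.1.prod (w.2.1.prod ((0 : A.Par →L[ℝ] Vec A.de).prod (.id ℝ A.Par)))),
    fun t => M (z.2.2 t, w.2.2 t, e, t))

/-- Neighbor sampling with `r l` samples in layer `l`: the program that estimates `z_v^(l)` and
its gradient with respect to the parameters at `θ`. The gradient is propagated by the chain
rule along with the values. Multiplication by `deg(v) / r`, evaluating the update function, and
evaluating and propagating its Jacobian cost one unit of time each. At a node without neighbors
the aggregated message is `0`. -/
def neighborSampling (A : MPNN) (r : ℕ → ℕ) {n : ℕ} (θ : A.Par) :
    (l : ℕ) → Fin n → A.Prog n (A.Estimate (A.Emb l))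
  | 0, v => do
    let x : A.Emb 0 ← Prog.query (.feature v)
    return (x, 0, fun _ => x)
  | l + 1, v => do
    let z ← neighborSampling A r θ l v
    let d : ℕ ← Prog.query (.degree v)
    let s : A.Estimate (A.Agg l) ←
      match d with
      | 0 => pure 0
      | N + 1 => Prog.sum (sampleMessage A θ l (neighborSampling A r θ l) v z N) (r (l + 1))
    Prog.tick 3
    let h : A.Estimate (A.Agg l) := ((d : ℝ) / (r (l + 1) : ℝ)) • s
    return (A.upd l (z.1, h.1, θ),
      (fderiv ℝ (A.upd l) (z.1, h.1, θ)).comp (z.2.1.prod (h.2.1.prod (.id ℝ A.Par))),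
      fun t => A.upd l (z.2.2 t, h.2.2 t, t))

end MPNN

/-- The Frobenius norm of a Jacobian. -/
def frobeniusNorm {p d : ℕ} (D : Vec p →L[ℝ] Vec d) : ℝ :=
  Real.sqrt (∑ i, ∑ j, (D (EuclideanSpace.single j 1) i) ^ 2)

end

open scoped NNReal

noncomputable section

/-! Value and gradient are estimated together: a pair of a value and a Jacobian (a jet) passes
through a layer by `tangent f`, which sends (x, X) to (f x, Df(x) X). On bounded sets `tangent f` is
bounded if f is Lipschitz, and Lipschitz if Df is too. So neighbor sampling acts on jets like a
network with locally Lipschitz layers. All jets, exact or estimated, stay in balls of radius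
`radius`, whatever the samples are: the scaled messages are bounded, and averaging preserves bounds
(`exactJet_spec`, `surely_neighborSampling_sound`).

The error is controlled by exponential moments, not by a union bound over sampled nodes. With m
samples in every layer, induction on the layer gives E exp(t ‖error‖) ≤ a exp(c t² / m) for all t ≥
0, with a and c independent of the input (`exists_avg_exp_error_le`). For the step, fix the estimate
z of the node itself. The aggregated jet is then a mean of m independent terms. Finitely many linear
functionals dominate the norm, and for each of them the exponential moment is a product of m
factors. A term differs from the exact mean in two ways. The choice of the neighbor contributes a
bounded centered variable, handled by Hoeffding's lemma. The inexact inputs contribute a Lipschitz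
multiple of the errors of z and of the neighbor's estimate.

The point is that the neighbors' errors do not cost a^m. Each term carries weight t/m, and by Jensen
its moment is at most the m-th root of the moment at t. The product of the m factors therefore costs
a only once (`avg_exp_sumMessages_le`). Averaging over z uses the induction hypothesis a second
time.

Markov's inequality with the best t gives a tail a exp(-m ε² / Q). Hence m of order ε⁻² log(1/δ)
suffices in every layer, even without the log(1/ε) allowed in the inner layers, and the recursion
takes time at most (20 m)^L. -/

namespace MPNN

/-! ### Sure properties, expectations and Markov's inequality for programs -/

namespace Prog

variable {A : MPNN} {I : A.Input} {α β : Type}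

/-- The property `Q` holds for all possible results and running times. -/
def Surely (I : A.Input) (P : A.Prog I.n α) (Q : α × ℕ → Prop) : Prop :=
  ∀ o ∈ (P.run I).support, Q o

theorem surely_pure {a : α} {Q : α × ℕ → Prop} :
    Surely I (pure a) Q ↔ Q (a, 0) := by
  change (∀ o ∈ (PMF.pure (a, 0)).support, Q o) ↔ _
  simp

theorem surely_ret {a : α} {Q : α × ℕ → Prop} :
    Surely I (ret a) Q ↔ Q (a, 0) := surely_pure

theorem surely_ask {q : A.Query I.n} {k : q.Answer → A.Prog I.n α} {Q : α × ℕ → Prop} :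
    Surely I (ask q k) Q ↔ Surely I (k (I.answer q)) (fun o => Q (o.1, o.2 + 1)) := by
  simp only [Surely, run, PMF.mem_support_map_iff]
  grind

theorem surely_spend {c : ℕ} {k : A.Prog I.n α} {Q : α × ℕ → Prop} :
    Surely I (spend c k) Q ↔ Surely I k (fun o => Q (o.1, o.2 + c)) := by
  simp only [Surely, run, PMF.mem_support_map_iff]
  grind

theorem surely_sample {N : ℕ} {k : Fin (N + 1) → A.Prog I.n α} {Q : α × ℕ → Prop} :
    Surely I (sample N k) Q ↔ ∀ i, Surely I (k i) (fun o => Q (o.1, o.2 + 1)) := by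
  simp only [Surely, run, PMF.mem_support_bind_iff, PMF.mem_support_map_iff,
    PMF.support_uniformOfFintype]
  exact ⟨fun h i o ho => h _ ⟨i, trivial, o, ho, rfl⟩,
    fun h o ⟨i, _, o', ho, e⟩ => e ▸ h i o' ho⟩

theorem surely_bind {P : A.Prog I.n α} {f : α → A.Prog I.n β} {Q : β × ℕ → Prop} :
    Surely I (P >>= f) Q ↔
      Surely I P (fun o => Surely I (f o.1) (fun o' => Q (o'.1, o.2 + o'.2))) := by
  change Surely I (bind P f) Q ↔ _
  induction P generalizing Q with
  | ret a => simp [bind, surely_ret]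
  | ask q k ih => simp [bind, surely_ask, ih, add_right_comm]
  | sample N k ih => simp [bind, surely_sample, ih, add_right_comm]
  | spend c k ih => simp [bind, surely_spend, ih, add_right_comm]

theorem surely_tick {c : ℕ} {Q : Unit × ℕ → Prop} :
    Surely I (tick c) Q ↔ Q ((), c) := by
  simp [tick, surely_spend, surely_ret]

theorem Surely.mono {P : A.Prog I.n α} {Q Q' : α × ℕ → Prop} (h : Surely I P Q)
    (hQ : ∀ o, Q o → Q' o) : Surely I P Q' := fun o ho => hQ o (h o ho)

theorem surely_sum [Zero α] [Add α] {P : A.Prog I.n α} {p : α × ℕ → Prop}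
    {q : ℕ → α × ℕ → Prop} (hP : Surely I P p) (h0 : q 0 (0, 0))
    (hs : ∀ n s a, q n s → p a → q (n + 1) (s.1 + a.1, s.2 + (a.2 + 1))) (n : ℕ) :
    Surely I (sum P n) (q n) := by
  induction n with
  | zero => exact surely_pure.2 h0
  | succ n ih =>
    simp only [sum, surely_bind, surely_tick, surely_pure]
    exact ih.mono fun s hq => hP.mono fun a ha => hs n s a hq ha

/-- The expected value of `f` at the result of a program. -/
def avg (I : A.Input) : A.Prog I.n α → (α → ℝ) → ℝ
  | ret a, f => f a
  | ask q k, f => avg I (k (I.answer q)) f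
  | sample N k, f => (∑ i, avg I (k i) f) / (N + 1 : ℕ)
  | spend _ k, f => avg I k f

theorem avg_bind (P : A.Prog I.n α) (f : α → A.Prog I.n β) (g : β → ℝ) :
    avg I (P >>= f) g = avg I P (fun a => avg I (f a) g) := by
  change avg I (bind P f) g = _
  induction P with
  | ret a => rfl
  | ask q k ih => simp [bind, avg, ih]
  | sample N k ih => simp [bind, avg, ih]
  | spend c k ih => simp [bind, avg, ih]

theorem avg_pure (a : α) (f : α → ℝ) : avg I (pure a) f = f a := rfl

theorem avg_tick (c : ℕ) (f : Unit → ℝ) : avg I (tick c) f = f () := rfl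

theorem avg_mono {P : A.Prog I.n α} {f g : α → ℝ} (h : Surely I P (fun o => f o.1 ≤ g o.1)) :
    avg I P f ≤ avg I P g := by
  induction P with
  | ret a => exact surely_ret.1 h
  | ask q k ih => exact ih _ (surely_ask.1 h)
  | sample N k ih =>
    simp only [avg]
    gcongr with i
    exact ih i (surely_sample.1 h i)
  | spend c k ih => exact ih (surely_spend.1 h)

theorem avg_mono_of_le {P : A.Prog I.n α} {f g : α → ℝ} (h : ∀ a, f a ≤ g a) :
    avg I P f ≤ avg I P g := avg_mono fun o _ => h o.1

theorem avg_const (P : A.Prog I.n α) (c : ℝ) : avg I P (fun _ => c) = c := by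
  induction P with
  | ret a => rfl
  | ask q k ih => exact ih _
  | sample N k ih =>
    simp only [avg, ih, Finset.sum_const, Finset.card_univ, Fintype.card_fin, nsmul_eq_mul]
    field_simp
  | spend c k ih => exact ih

theorem avg_nonneg {P : A.Prog I.n α} {f : α → ℝ} (h : ∀ a, 0 ≤ f a) : 0 ≤ avg I P f :=
  (avg_const P 0).symm.le.trans (avg_mono_of_le h)

theorem avg_const_mul (P : A.Prog I.n α) (c : ℝ) (f : α → ℝ) :
    avg I P (fun a => c * f a) = c * avg I P f := by
  induction P with
  | ret a => rfl
  | ask q k ih => exact ih _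
  | sample N k ih => simp only [avg, ih, ← Finset.mul_sum, mul_div_assoc]
  | spend c k ih => exact ih

theorem avg_finset_sum {ι : Type*} (P : A.Prog I.n α) (s : Finset ι) (f : ι → α → ℝ) :
    avg I P (fun a => ∑ i ∈ s, f i a) = ∑ i ∈ s, avg I P (f i) := by
  induction P with
  | ret a => rfl
  | ask q k ih => exact ih _
  | sample N k ih =>
    simp only [avg, ih]
    rw [Finset.sum_comm, Finset.sum_div]
  | spend c k ih => exact ih

/-- Jensen's inequality, applied at each uniform draw. It is what lets m small factors be replaced
by one moment with an m times larger exponent. -/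
theorem avg_pow_le {P : A.Prog I.n α} {f : α → ℝ} (h : ∀ a, 0 ≤ f a) (r : ℕ) :
    avg I P f ^ r ≤ avg I P (fun a => f a ^ r) := by
  induction P with
  | ret a => exact le_rfl
  | ask q k ih => exact ih _
  | sample N k ih =>
    simp only [avg, Finset.sum_div]
    have hN : ((N + 1 : ℕ) : ℝ) ≠ 0 := by positivity
    have := Real.pow_arith_mean_le_arith_mean_pow Finset.univ
      (fun _ : Fin (N + 1) => ((N + 1 : ℕ) : ℝ)⁻¹) (fun i => avg I (k i) f)
      (fun _ _ => by positivity) (by simp [hN, -Nat.cast_add, -Nat.cast_one])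
      (fun i _ => avg_nonneg h) r
    simp only [div_eq_inv_mul]
    refine this.trans (Finset.sum_le_sum fun i _ => ?_)
    gcongr
    exact ih i
  | spend c k ih => exact ih

/-- The expected value of a multiplicative function of a sum of independent results. -/
theorem avg_sum_of_mul [Zero α] [Add α] (P : A.Prog I.n α) {f : α → ℝ} (h0 : f 0 = 1)
    (hadd : ∀ a b, f (a + b) = f a * f b) (r : ℕ) : avg I (sum P r) f = avg I P f ^ r := by
  induction r with
  | zero => exact h0
  | succ r ih =>
    simp only [sum, avg_bind, avg_tick, avg_pure, hadd, avg_const_mul]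
    rw [pow_succ, ← ih, mul_comm, ← avg_const_mul]
    simp only [mul_comm]

/-- The probability of an event is at most the expected value of every function that is
nonnegative, and at least `1` on the event. -/
theorem toOuterMeasure_run_le (P : A.Prog I.n α) {S : Set (α × ℕ)} {f : α → ℝ}
    (hf : ∀ a, 0 ≤ f a) (hS : ∀ o ∈ S, 1 ≤ f o.1) :
    (P.run I).toOuterMeasure S ≤ ENNReal.ofReal (avg I P f) := by
  induction P generalizing S with
  | ret a =>
    simp only [run, avg, PMF.toOuterMeasure_pure_apply]
    split_ifs with h
    · exact ENNReal.one_le_ofReal.2 (hS _ h)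
    · exact zero_le
  | ask q k ih =>
    simp only [run, avg, PMF.toOuterMeasure_map_apply]
    exact ih _ fun o ho => hS (o.1, o.2 + 1) ho
  | sample N k ih =>
    simp only [run, avg, PMF.toOuterMeasure_bind_apply, tsum_fintype,
      PMF.toOuterMeasure_map_apply, PMF.uniformOfFintype_apply, Fintype.card_fin]
    rw [← Finset.mul_sum, div_eq_inv_mul, ENNReal.ofReal_mul (by positivity),
      ENNReal.ofReal_inv_of_pos (by positivity), ENNReal.ofReal_natCast,
      ENNReal.ofReal_sum_of_nonneg fun i _ => avg_nonneg hf]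
    gcongr with i
    exact ih i fun o ho => hS (o.1, o.2 + 1) ho
  | spend c k ih =>
    simp only [run, avg, PMF.toOuterMeasure_map_apply]
    exact ih fun o ho => hS (o.1, o.2 + c) ho

end Prog

end MPNN

/-! ### Boundedness and Lipschitz continuity of the action on jets -/

/-- The action of `f` on pairs of a value and a Jacobian. -/
def tangent {P X Y : Type} [NormedAddCommGroup P] [NormedSpace ℝ P] [NormedAddCommGroup X]
    [NormedSpace ℝ X] [NormedAddCommGroup Y] [NormedSpace ℝ Y] (f : X → Y)
    (x : X × (P →L[ℝ] X)) : Y × (P →L[ℝ] Y) :=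
  (f x.1, (fderiv ℝ f x.1).comp x.2)

section Tangent

variable {P X Y : Type} [NormedAddCommGroup P] [NormedSpace ℝ P] [NormedAddCommGroup X]
    [NormedSpace ℝ X] [NormedAddCommGroup Y] [NormedSpace ℝ Y]

namespace MPNN.LipschitzOnBounded

variable {f : X → Y} {K K' : ℝ → ℝ≥0} {R : ℝ}

/-- The radius grows by 1 because the derivative is bounded by a Lipschitz constant on a
neighborhood of the point, and the point may lie on the boundary of the ball of radius R. -/
theorem norm_fderiv_le (hf : LipschitzOnBounded K f) {x : X} (hx : ‖x‖ ≤ R) :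
    ‖fderiv ℝ f x‖ ≤ K (R + 1) := by
  refine norm_fderiv_le_of_lipschitzOn ℝ (s := Metric.closedBall 0 (R + 1)) ?_ (hf (R + 1))
  refine Filter.mem_of_superset (Metric.ball_mem_nhds x one_pos) fun y hy => ?_
  rw [mem_closedBall_zero_iff]
  rw [mem_ball_iff_norm] at hy
  have := norm_le_norm_add_norm_sub' y x
  linarith

theorem norm_tangent_le (hf : LipschitzOnBounded K f) {c : ℝ} (hc : ‖f 0‖ ≤ c)
    {x : X × (P →L[ℝ] X)} (hx : ‖x‖ ≤ R) :
    ‖tangent f x‖ ≤ c + K R * R + K (R + 1) * R := by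
  have hR : 0 ≤ R := (norm_nonneg x).trans hx
  have hc0 : 0 ≤ c := (norm_nonneg _).trans hc
  have h1 : ‖x.1‖ ≤ R := (norm_fst_le x).trans hx
  have h2 : ‖x.2‖ ≤ R := (norm_snd_le x).trans hx
  refine norm_prod_le_iff.2 ⟨?_, ?_⟩
  · have h3 := (hf R).norm_sub_le (x := x.1) (y := 0) (by simpa using h1) (by simpa using hR)
    have h4 := norm_le_norm_add_norm_sub' (f x.1) (f 0)
    rw [sub_zero] at h3
    have h5 : (K R : ℝ) * ‖x.1‖ ≤ K R * R := by gcongr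
    have h6 : 0 ≤ (K (R + 1) : ℝ) * R := by positivity
    change ‖f x.1‖ ≤ _
    linarith
  · change ‖(fderiv ℝ f x.1).comp x.2‖ ≤ _
    have h3 := ContinuousLinearMap.opNorm_comp_le (fderiv ℝ f x.1) x.2
    have h4 : ‖fderiv ℝ f x.1‖ * ‖x.2‖ ≤ K (R + 1) * R := by
      gcongr
      exact hf.norm_fderiv_le h1
    have h5 : 0 ≤ (K R : ℝ) * R := by positivity
    linarith

/-- For the Jacobian part, Df(x) X - Df(y) Y = Df(x) (X - Y) + (Df(x) - Df(y)) Y. The second term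
uses the Lipschitz bound for Df and ‖Y‖ ≤ R. -/
theorem norm_tangent_sub_le (hf : LipschitzOnBounded K f)
    (hf' : LipschitzOnBounded K' (fderiv ℝ f)) {x y : X × (P →L[ℝ] X)} (hx : ‖x‖ ≤ R)
    (hy : ‖y‖ ≤ R) :
    ‖tangent f x - tangent f y‖ ≤ (K R + K (R + 1) + K' R * R) * ‖x - y‖ := by
  have hR : 0 ≤ R := (norm_nonneg x).trans hx
  have hx1 : ‖x.1‖ ≤ R := (norm_fst_le x).trans hx
  have hy1 : ‖y.1‖ ≤ R := (norm_fst_le y).trans hy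
  have hy2 : ‖y.2‖ ≤ R := (norm_snd_le y).trans hy
  have h1 : ‖x.1 - y.1‖ ≤ ‖x - y‖ := norm_fst_le (x - y)
  have h2 : ‖x.2 - y.2‖ ≤ ‖x - y‖ := norm_snd_le (x - y)
  have p1 : 0 ≤ (K R : ℝ) * ‖x - y‖ := by positivity
  have p2 : 0 ≤ (K (R + 1) : ℝ) * ‖x - y‖ := by positivity
  have p3 : 0 ≤ (K' R : ℝ) * R * ‖x - y‖ := by positivity
  refine norm_prod_le_iff.2 ⟨?_, ?_⟩
  · have h3 := (hf R).norm_sub_le (x := x.1) (y := y.1) (by simpa using hx1) (by simpa using hy1)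
    have h4 : (K R : ℝ) * ‖x.1 - y.1‖ ≤ K R * ‖x - y‖ := by gcongr
    change ‖f x.1 - f y.1‖ ≤ _
    linarith
  · change ‖(fderiv ℝ f x.1).comp x.2 - (fderiv ℝ f y.1).comp y.2‖ ≤ _
    have h3 : (fderiv ℝ f x.1).comp x.2 - (fderiv ℝ f y.1).comp y.2 =
        (fderiv ℝ f x.1).comp (x.2 - y.2) + (fderiv ℝ f x.1 - fderiv ℝ f y.1).comp y.2 := by
      ext t
      simp
    have h4 : ‖(fderiv ℝ f x.1).comp (x.2 - y.2)‖ ≤ K (R + 1) * ‖x - y‖ := by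
      refine (ContinuousLinearMap.opNorm_comp_le _ _).trans ?_
      gcongr
      exact hf.norm_fderiv_le hx1
    have h5 : ‖(fderiv ℝ f x.1 - fderiv ℝ f y.1).comp y.2‖ ≤ K' R * ‖x - y‖ * R := by
      refine (ContinuousLinearMap.opNorm_comp_le _ _).trans ?_
      have h6 := (hf' R).norm_sub_le (x := x.1) (y := y.1) (by simpa using hx1)
        (by simpa using hy1)
      gcongr
      exact h6.trans (by gcongr)
    rw [h3]
    refine (norm_add_le _ _).trans ?_
    linarith

end MPNN.LipschitzOnBounded

theorem hasFDerivAt_comp_tangent {f : X → Y} (hf : Differentiable ℝ f) {g : P → X}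
    {D : P →L[ℝ] X} {t : P} (hg : HasFDerivAt g D t) :
    HasFDerivAt (fun s => f (g s)) (tangent f (g t, D)).2 t :=
  (hf (g t)).hasFDerivAt.comp t hg

end Tangent

/-! ### Norming functionals, Hoeffding's lemma, Frobenius norm -/

/-- On a finite-dimensional space, the norm is bounded by the maximum of finitely many continuous
linear functionals. -/
theorem exists_finset_norm_le_apply (V : Type*) [NormedAddCommGroup V] [NormedSpace ℝ V]
    [FiniteDimensional ℝ V] :
    ∃ s : Finset (V →L[ℝ] ℝ), ∀ v, ∃ φ ∈ s, ‖v‖ ≤ φ v := by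
  classical
  let e := ContinuousLinearEquiv.ofFinrankEq (𝕜 := ℝ) (E := V)
    (F := Fin (Module.finrank ℝ V) → ℝ) (by simp)
  let c : ℝ := ‖(e.symm : (Fin (Module.finrank ℝ V) → ℝ) →L[ℝ] V)‖
  let ψ (i : Fin (Module.finrank ℝ V)) : V →L[ℝ] ℝ :=
    c • (ContinuousLinearMap.proj i).comp (e : V →L[ℝ] (Fin (Module.finrank ℝ V) → ℝ))
  -- The functionals are the coordinates with both signs, scaled by the norm of the inverse
  -- coordinate map. The functional 0 serves spaces of dimension 0, which have no coordinates.
  refine ⟨insert 0 (Finset.univ.image ψ ∪ Finset.univ.image fun i => -ψ i), fun v => ?_⟩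
  have h1 : ‖v‖ ≤ c * ‖e v‖ := by
    simpa [c] using (e.symm : (Fin (Module.finrank ℝ V) → ℝ) →L[ℝ] V).le_opNorm (e v)
  rcases isEmpty_or_nonempty (Fin (Module.finrank ℝ V)) with h | h
  · refine ⟨0, by simp, h1.trans ?_⟩
    have : e v = 0 := Subsingleton.elim _ _
    simp [this]
  obtain ⟨i, hi⟩ := Finite.exists_max fun i => ‖e v i‖
  have h2 : ‖v‖ ≤ c * |e v i| :=
    h1.trans (by gcongr; exact (pi_norm_le_iff_of_nonneg (norm_nonneg _)).2 hi)
  rcases abs_cases (e v i) with ⟨h3, -⟩ | ⟨h3, -⟩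
  · exact ⟨ψ i, by simp, by simpa [ψ, h3] using h2⟩
  · exact ⟨-ψ i, by simp, by simpa [ψ, h3] using h2⟩

/-- Hoeffding's lemma for a uniformly random element of a finite set. -/
theorem sum_exp_le_of_sum_eq_zero {ι : Type*} (s : Finset ι) (y : ι → ℝ) {b : ℝ}
    (hb : ∀ i ∈ s, |y i| ≤ b) (h0 : ∑ i ∈ s, y i = 0) :
    ∑ i ∈ s, Real.exp (y i) ≤ s.card * Real.exp (b ^ 2 / 2) := by
  -- The graph of exp lies below its chord over [-b, b]; the linear term of the chord cancels in the
  -- sum. For b = 0 the slope is 0 / 0 = 0, and y i = 0.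
  have key : ∀ i ∈ s, Real.exp (y i) ≤ Real.cosh b + y i * (Real.sinh b / b) := by
    intro i hi
    obtain ⟨h1, h2⟩ := abs_le.1 (hb i hi)
    rcases (show 0 ≤ b by linarith).eq_or_lt with rfl | hpos
    · have : y i = 0 := by linarith
      simp [this]
    have := convexOn_exp.2 (Set.mem_univ (-b)) (Set.mem_univ b) 
      (show 0 ≤ (b - y i) / (2 * b) by apply div_nonneg <;> linarith)
      (show 0 ≤ (b + y i) / (2 * b) by apply div_nonneg <;> linarith)
      (by field_simp; ring)
    simp only [smul_eq_mul] at this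
    have e1 : (b - y i) / (2 * b) * (-b) + (b + y i) / (2 * b) * b = y i := by
      field_simp; ring
    rw [e1] at this
    refine this.trans (le_of_eq ?_)
    rw [Real.cosh_eq, Real.sinh_eq]
    field_simp
    ring
  calc ∑ i ∈ s, Real.exp (y i) ≤ ∑ i ∈ s, (Real.cosh b + y i * (Real.sinh b / b)) :=
        Finset.sum_le_sum key
    _ = s.card * Real.cosh b := by
        rw [Finset.sum_add_distrib, ← Finset.sum_mul, h0]; simp
    _ ≤ s.card * Real.exp (b ^ 2 / 2) := by
        gcongr
        exact Real.cosh_le_exp_half_sq b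

/-- Each of the p columns has norm at most ‖D‖. The crude factor p + 1 is positive even when p = 0,
so that it can be divided by. -/
theorem frobeniusNorm_le {p d : ℕ} (D : Vec p →L[ℝ] Vec d) :
    frobeniusNorm D ≤ (p + 1) * ‖D‖ := by
  refine Real.sqrt_le_iff.2 ⟨by positivity, ?_⟩
  rw [Finset.sum_comm]
  calc ∑ j : Fin p, ∑ i : Fin d, (D (EuclideanSpace.single j 1) i) ^ 2
      = ∑ j : Fin p, ‖D (EuclideanSpace.single j 1)‖ ^ 2 := by
        simp [EuclideanSpace.norm_sq_eq]
    _ ≤ ∑ j : Fin p, ‖D‖ ^ 2 := by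
        gcongr with j
        simpa using D.le_opNorm (EuclideanSpace.single j 1)
    _ = p * ‖D‖ ^ 2 := by simp
    _ ≤ ((p + 1) * ‖D‖) ^ 2 := by
        rw [mul_pow]
        gcongr
        nlinarith [Nat.cast_nonneg (α := ℝ) p]

/-! ### Estimates as jets, and the chain rule -/

namespace MPNN

variable {A : MPNN} {I : A.Input} {l : ℕ}

section Estimates

variable {E : Type} [NormedAddCommGroup E] [NormedSpace ℝ E]

/-- The estimated value together with the estimated Jacobian. -/
def jet (a : A.Estimate E) : E × (A.Par →L[ℝ] E) := (a.1, a.2.1)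

theorem jet_zero : jet (0 : A.Estimate E) = 0 := rfl

theorem jet_add (a b : A.Estimate E) : jet (a + b) = jet a + jet b := rfl

theorem jet_smul (c : ℝ) (a : A.Estimate E) : jet (c • a) = c • jet a := rfl

/-- The value and the Jacobian of an estimate are those of the recorded function. -/
def Sound (θ : A.Par) (a : A.Estimate E) : Prop :=
  a.1 = a.2.2 θ ∧ HasFDerivAt a.2.2 a.2.1 θ

theorem Sound.zero (θ : A.Par) : Sound θ (0 : A.Estimate E) :=
  ⟨rfl, hasFDerivAt_const (0 : E) θ⟩

theorem Sound.add {θ : A.Par} {a b : A.Estimate E} (ha : Sound θ a) (hb : Sound θ b) :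
    Sound θ (a + b) :=
  ⟨congrArg₂ (· + ·) ha.1 hb.1, ha.2.add hb.2⟩

theorem Sound.smul {θ : A.Par} {a : A.Estimate E} (ha : Sound θ a) (c : ℝ) :
    Sound θ (c • a) :=
  ⟨congrArg (c • ·) ha.1, ha.2.const_smul c⟩

end Estimates

/-- Arguments of a message function, with Jacobians. -/
def msgInput (e : Vec A.de) (θ : A.Par) (z w : A.Emb l × (A.Par →L[ℝ] A.Emb l)) :
    A.MsgArg l × (A.Par →L[ℝ] A.MsgArg l) :=
  ((z.1, w.1, e, θ), z.2.prod (w.2.prod ((0 : A.Par →L[ℝ] Vec A.de).prod (.id ℝ A.Par))))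

/-- Arguments of an update function, with Jacobians. -/
def updInput (θ : A.Par) (z : A.Emb l × (A.Par →L[ℝ] A.Emb l))
    (h : A.Agg l × (A.Par →L[ℝ] A.Agg l)) :
    (A.Emb l × A.Agg l × A.Par) × (A.Par →L[ℝ] A.Emb l × A.Agg l × A.Par) :=
  ((z.1, h.1, θ), z.2.prod (h.2.prod (.id ℝ A.Par)))

/-- The Jacobian of the parameter argument is the identity, which is why 1 ≤ R is required. -/
theorem norm_msgInput_le {e : Vec A.de} {θ : A.Par} {z w : A.Emb l × (A.Par →L[ℝ] A.Emb l)}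
    {R : ℝ} (hR : 1 ≤ R) (he : ‖e‖ ≤ R) (hθ : ‖θ‖ ≤ R) (hz : ‖z‖ ≤ R) (hw : ‖w‖ ≤ R) :
    ‖msgInput e θ z w‖ ≤ R := by
  rw [norm_prod_le_iff] at hz hw
  simp only [msgInput, norm_prod_le_iff, ContinuousLinearMap.opNorm_prod]
  exact ⟨⟨hz.1, hw.1, he, hθ⟩, hz.2, hw.2, by simp; linarith,
    ContinuousLinearMap.norm_id_le.trans hR⟩

theorem norm_updInput_le {θ : A.Par} {z : A.Emb l × (A.Par →L[ℝ] A.Emb l)}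
    {h : A.Agg l × (A.Par →L[ℝ] A.Agg l)}
    {R : ℝ} (hR : 1 ≤ R) (hθ : ‖θ‖ ≤ R) (hz : ‖z‖ ≤ R) (hh : ‖h‖ ≤ R) :
    ‖updInput θ z h‖ ≤ R := by
  rw [norm_prod_le_iff] at hz hh
  simp only [updInput, norm_prod_le_iff, ContinuousLinearMap.opNorm_prod]
  exact ⟨⟨hz.1, hh.1, hθ⟩, hz.2, hh.2, ContinuousLinearMap.norm_id_le.trans hR⟩

theorem norm_msgInput_sub_le (e : Vec A.de) (θ : A.Par)
    (z w z' w' : A.Emb l × (A.Par →L[ℝ] A.Emb l)) :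
    ‖msgInput e θ z w - msgInput e θ z' w'‖ ≤ ‖z - z'‖ + ‖w - w'‖ := by
  have e1 : msgInput e θ z w - msgInput e θ z' w' =
      (((z - z').1, (w - w').1, 0, 0), (z - z').2.prod ((w - w').2.prod
        ((0 : A.Par →L[ℝ] Vec A.de).prod (0 : A.Par →L[ℝ] A.Par)))) := by
    ext <;> simp [msgInput]
  have h1 := norm_fst_le (z - z')
  have h2 := norm_snd_le (z - z')
  have h3 := norm_fst_le (w - w')
  have h4 := norm_snd_le (w - w')
  have h5 := norm_nonneg (z - z')
  have h6 := norm_nonneg (w - w')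
  rw [e1]
  simp only [norm_prod_le_iff, ContinuousLinearMap.opNorm_prod, norm_zero]
  refine ⟨⟨?_, ?_, ?_, ?_⟩, ?_, ?_, ?_, ?_⟩ <;> linarith

theorem norm_updInput_sub_le (θ : A.Par) (z z' : A.Emb l × (A.Par →L[ℝ] A.Emb l))
    (h h' : A.Agg l × (A.Par →L[ℝ] A.Agg l)) :
    ‖updInput θ z h - updInput θ z' h'‖ ≤ ‖z - z'‖ + ‖h - h'‖ := by
  have e1 : updInput θ z h - updInput θ z' h' =
      (((z - z').1, (h - h').1, 0), (z - z').2.prod ((h - h').2.prod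
        (0 : A.Par →L[ℝ] A.Par))) := by
    ext <;> simp [updInput]
  have h1 := norm_fst_le (z - z')
  have h2 := norm_snd_le (z - z')
  have h3 := norm_fst_le (h - h')
  have h4 := norm_snd_le (h - h')
  have h5 := norm_nonneg (z - z')
  have h6 := norm_nonneg (h - h')
  rw [e1]
  simp only [norm_prod_le_iff, ContinuousLinearMap.opNorm_prod, norm_zero]
  refine ⟨⟨?_, ?_, ?_⟩, ?_, ?_, ?_⟩ <;> linarith

/-- The estimate of a message that is computed from estimates of the embeddings. -/
def messageEstimate (θ : A.Par) (e : Vec A.de) (M : A.MsgArg l → A.Agg l)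
    (z w : A.Estimate (A.Emb l)) : A.Estimate (A.Agg l) :=
  (M (z.1, w.1, e, θ),
    (fderiv ℝ M (z.1, w.1, e, θ)).comp
      (z.2.1.prod (w.2.1.prod ((0 : A.Par →L[ℝ] Vec A.de).prod (.id ℝ A.Par)))),
    fun t => M (z.2.2 t, w.2.2 t, e, t))

/-- The estimate of an embedding that is computed from estimates of the previous embedding and of
the aggregated messages. -/
def updateEstimate (θ : A.Par) (z : A.Estimate (A.Emb l)) (h : A.Estimate (A.Agg l)) :
    A.Estimate (A.Emb (l + 1)) :=
  (A.upd l (z.1, h.1, θ),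
    (fderiv ℝ (A.upd l) (z.1, h.1, θ)).comp (z.2.1.prod (h.2.1.prod (.id ℝ A.Par))),
    fun t => A.upd l (z.2.2 t, h.2.2 t, t))

theorem jet_updateEstimate (θ : A.Par) (z : A.Estimate (A.Emb l)) (h : A.Estimate (A.Agg l)) :
    jet (updateEstimate θ z h) = tangent (A.upd l) (updInput θ (jet z) (jet h)) := rfl

/-- The factor moves inside because the assumptions bound the degree times the message function, not
the message function itself. -/
theorem smul_jet_messageEstimate (c : ℝ) (θ : A.Par) (e : Vec A.de) (M : A.MsgArg l → A.Agg l)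
    (z w : A.Estimate (A.Emb l)) :
    c • jet (messageEstimate θ e M z w) =
      tangent (fun q => c • M q) (msgInput e θ (jet z) (jet w)) := by
  have h := fderiv_const_smul_field (𝕜 := ℝ) (f := M) c
  ext t
  · rfl
  · change _ = (fderiv ℝ (c • M) (z.1, w.1, e, θ)).comp _ t _
    rw [h]
    rfl

theorem Sound.messageEstimate {θ : A.Par} {e : Vec A.de} {M : A.MsgArg l → A.Agg l}
    {z w : A.Estimate (A.Emb l)} (hM : Differentiable ℝ M) (hz : Sound θ z) (hw : Sound θ w) :
    Sound θ (messageEstimate θ e M z w) := by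
  refine ⟨by simp [MPNN.messageEstimate, hz.1, hw.1], ?_⟩
  have := hasFDerivAt_comp_tangent hM
    (hz.2.prodMk (hw.2.prodMk ((hasFDerivAt_const e θ).prodMk (hasFDerivAt_id θ))))
  simp only [tangent, id, ← hz.1, ← hw.1] at this
  exact this

theorem Sound.updateEstimate {θ : A.Par} {z : A.Estimate (A.Emb l)} {h : A.Estimate (A.Agg l)}
    (hU : Differentiable ℝ (A.upd l)) (hz : Sound θ z) (hh : Sound θ h) :
    Sound θ (updateEstimate θ z h) := by
  refine ⟨by simp [MPNN.updateEstimate, hz.1, hh.1], ?_⟩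
  have := hasFDerivAt_comp_tangent hU (hz.2.prodMk (hh.2.prodMk (hasFDerivAt_id θ)))
  simp only [tangent, id, ← hz.1, ← hh.1] at this
  exact this

/-! ### The neighbor sampling program -/

theorem sampleMessage_eq (A : MPNN) {n : ℕ} (θ : A.Par) (l : ℕ)
    (est : Fin n → A.Prog n (A.Estimate (A.Emb l))) (v : Fin n) (z : A.Estimate (A.Emb l))
    (N : ℕ) :
    A.sampleMessage θ l est v z N =
      .sample N fun i => .ask (.neighbor v i) fun u => est u >>= fun w =>
        .ask (.edge v u) fun e => .ask (.message l v u) fun M =>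
          .spend 2 (.ret (messageEstimate θ e M z w)) := rfl

theorem answer_neighbor_mem {v : Fin I.n} {i : ℕ} (hi : i < deg I.G v) :
    I.answer (.neighbor v i) ∈ neighbors I.G v := by
  have h : (neighbors I.G v).orderEmbOfFin rfl ⟨i, hi⟩ ∈ neighbors I.G v :=
    Finset.orderEmbOfFin_mem _ _ _
  have e : I.answer (.neighbor v i) = (neighbors I.G v).orderEmbOfFin rfl ⟨i, hi⟩ := dif_pos hi
  rwa [e]

theorem sum_answer_neighbor {v : Fin I.n} {m : ℕ} (hm : deg I.G v = m) (F : Fin I.n → ℝ) :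
    ∑ i : Fin m, F (I.answer (.neighbor v i)) = ∑ u ∈ neighbors I.G v, F u := by
  subst hm
  conv_rhs => rw [← Finset.map_orderEmbOfFin_univ (neighbors I.G v) rfl, Finset.sum_map]
  refine Finset.sum_congr rfl fun i _ => ?_
  exact congrArg F (dif_pos i.2)

/-- The order embedding enumerates the neighbors, so a uniform index is a uniform neighbor. -/
theorem avg_sampleMessage (θ : A.Par) (est : Fin I.n → A.Prog I.n (A.Estimate (A.Emb l)))
    (v : Fin I.n) (z : A.Estimate (A.Emb l)) {N : ℕ} (hN : deg I.G v = N + 1)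
    (f : A.Estimate (A.Agg l) → ℝ) :
    Prog.avg I (A.sampleMessage θ l est v z N) f =
      (∑ u ∈ neighbors I.G v, Prog.avg I (est u)
        (fun w => f (messageEstimate θ (I.e v u) (A.msg I.G l v u) z w))) / deg I.G v := by
  rw [sampleMessage_eq, hN]
  simp only [Prog.avg, Prog.avg_bind]
  rw [← sum_answer_neighbor hN]
  rfl

/-- The 6 units are one draw, three queries (neighbor, edge, message) and the two units for the
message and its Jacobian. -/
theorem surely_sampleMessage {θ : A.Par} {est : Fin I.n → A.Prog I.n (A.Estimate (A.Emb l))}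
    {v : Fin I.n} {z : A.Estimate (A.Emb l)} {N : ℕ} (hN : deg I.G v = N + 1)
    {Q : A.Estimate (A.Agg l) × ℕ → Prop}
    (h : ∀ u ∈ neighbors I.G v, Prog.Surely I (est u) (fun o =>
      Q (messageEstimate θ (I.e v u) (A.msg I.G l v u) z o.1, o.2 + 6))) :
    Prog.Surely I (A.sampleMessage θ l est v z N) Q := by
  simp only [sampleMessage_eq, Prog.surely_sample, Prog.surely_ask, Prog.surely_bind,
    Prog.surely_spend, Prog.surely_ret]
  intro i
  refine (h _ (answer_neighbor_mem (hN.symm ▸ i.2 : (i : ℕ) < deg I.G v))).mono fun o ho => ho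

/-- The sum of the estimated messages from `m` sampled neighbors of `v`, if `d` is its degree. -/
def sumMessages (A : MPNN) {n : ℕ} (θ : A.Par) (l : ℕ)
    (est : Fin n → A.Prog n (A.Estimate (A.Emb l))) (v : Fin n) (z : A.Estimate (A.Emb l))
    (m : ℕ) : ℕ → A.Prog n (A.Estimate (A.Agg l))
  | 0 => pure 0
  | N + 1 => Prog.sum (A.sampleMessage θ l est v z N) m

theorem neighborSampling_succ (A : MPNN) (r : ℕ → ℕ) {n : ℕ} (θ : A.Par) (l : ℕ) (v : Fin n) :
    A.neighborSampling r θ (l + 1) v =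
      A.neighborSampling r θ l v >>= fun z => .ask (.degree v) fun d =>
        A.sumMessages θ l (A.neighborSampling r θ l) v z (r (l + 1)) d >>= fun s =>
          .spend 3 (.ret (updateEstimate θ z ((Nat.cast (R := ℝ) d / (r (l + 1) : ℝ)) • s))) := by
  rw [neighborSampling]
  congr 1
  funext z
  refine congrArg (Prog.ask (Query.degree v)) (funext fun d : ℕ => ?_)
  cases d <;> rfl

theorem avg_neighborSampling_succ (r : ℕ → ℕ) (θ : A.Par) (v : Fin I.n)
    (f : A.Estimate (A.Emb (l + 1)) → ℝ) :
    Prog.avg I (A.neighborSampling r θ (l + 1) v) f =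
      Prog.avg I (A.neighborSampling r θ l v) (fun z =>
        Prog.avg I (A.sumMessages θ l (A.neighborSampling r θ l) v z (r (l + 1)) (deg I.G v))
          (fun s => f (updateEstimate θ z (((deg I.G v : ℝ) / (r (l + 1) : ℝ)) • s)))) := by
  simp only [neighborSampling_succ, Prog.avg_bind, Prog.avg]
  rfl

theorem surely_neighborSampling_succ {r : ℕ → ℕ} {θ : A.Par} {v : Fin I.n}
    {Q : A.Estimate (A.Emb (l + 1)) × ℕ → Prop} :
    Prog.Surely I (A.neighborSampling r θ (l + 1) v) Q ↔
      Prog.Surely I (A.neighborSampling r θ l v) (fun o =>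
        Prog.Surely I (A.sumMessages θ l (A.neighborSampling r θ l) v o.1 (r (l + 1))
          (deg I.G v)) (fun o' =>
            Q (updateEstimate θ o.1 (((deg I.G v : ℝ) / (r (l + 1) : ℝ)) • o'.1),
              o.2 + (o'.2 + 3 + 1)))) := by
  simp only [neighborSampling_succ, Prog.surely_bind, Prog.surely_ask, Prog.surely_spend,
    Prog.surely_ret, zero_add]
  rfl

theorem avg_neighborSampling_zero (r : ℕ → ℕ) (θ : A.Par) (v : Fin I.n)
    (f : A.Estimate (A.Emb 0) → ℝ) :
    Prog.avg I (A.neighborSampling r θ 0 v) f = f (I.x v, 0, fun _ => I.x v) := rfl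

theorem surely_neighborSampling_zero {r : ℕ → ℕ} {θ : A.Par} {v : Fin I.n}
    {Q : A.Estimate (A.Emb 0) × ℕ → Prop} :
    Prog.Surely I (A.neighborSampling r θ 0 v) Q ↔ Q ((I.x v, 0, fun _ => I.x v), 1) := by
  exact (Prog.surely_ask (I := I) (q := .feature v)
    (k := fun x => .ret ((x, 0, fun _ => x) : A.Estimate (A.Emb 0)))).trans Prog.surely_ret

theorem surely_sumMessages {θ : A.Par} {est : Fin I.n → A.Prog I.n (A.Estimate (A.Emb l))}
    {v : Fin I.n} {z : A.Estimate (A.Emb l)} {p : A.Estimate (A.Agg l) × ℕ → Prop}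
    {q : ℕ → A.Estimate (A.Agg l) × ℕ → Prop}
    (h : ∀ u ∈ neighbors I.G v, Prog.Surely I (est u) (fun o =>
      p (messageEstimate θ (I.e v u) (A.msg I.G l v u) z o.1, o.2 + 6)))
    (h0 : ∀ n, q n (0, 0))
    (hs : ∀ n s a, q n s → p a → q (n + 1) (s.1 + a.1, s.2 + (a.2 + 1))) (m : ℕ) :
    Prog.Surely I (A.sumMessages θ l est v z m (deg I.G v)) (q m) := by
  rcases hd : deg I.G v with _ | N
  · exact Prog.surely_pure.2 (h0 m)
  · exact Prog.surely_sum (surely_sampleMessage hd h) (h0 0) hs m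

/-- The running time of neighbor sampling with `m` samples in every layer. -/
theorem time_neighborSampling {m : ℕ} (hm : 1 ≤ m) (θ : A.Par) (l : ℕ) (v : Fin I.n) :
    Prog.Surely I (A.neighborSampling (fun _ => m) θ l v) (fun o => o.2 ≤ (20 * m) ^ l) := by
  induction l generalizing v with
  | zero => exact surely_neighborSampling_zero.2 (by simp)
  | succ l ih =>
    rw [surely_neighborSampling_succ]
    refine (ih v).mono fun o ho => ?_
    refine (surely_sumMessages (p := fun o => o.2 ≤ (20 * m) ^ l + 6)
      (q := fun n o => o.2 ≤ n * ((20 * m) ^ l + 7)) (fun u _ => (ih u).mono fun o ho => ?_)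
      (by simp) (fun n s a hs ha => ?_) m).mono fun o' ho' => ?_
    · exact Nat.add_le_add_right ho 6
    · dsimp only at hs ha ⊢
      linarith
    · dsimp only at ho ho' ⊢
      -- With T = (20 m)^l, the time of the next layer is at most T + m (T + 7) + 4; since T ≥ 1 and
      -- m ≥ 1, this is below 20 m T.
      have h1 : 1 ≤ (20 * m) ^ l := Nat.one_le_pow _ _ (by omega)
      rw [pow_succ]
      nlinarith

end MPNN

namespace MPNN

variable {A : MPNN} {I : A.Input} {L l : ℕ} {B C₀ : ℝ} {K K' : ℝ → ℝ≥0}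

/-! ### Exact embeddings -/

theorem jet_sum {ι E : Type} [NormedAddCommGroup E] [NormedSpace ℝ E] (s : Finset ι)
    (a : ι → A.Estimate E) : jet (∑ i ∈ s, a i) = ∑ i ∈ s, jet (a i) :=
  map_sum (⟨⟨jet, jet_zero⟩, jet_add⟩ : A.Estimate E →+ E × (A.Par →L[ℝ] E)) a s

theorem Sound.sum {ι E : Type} [NormedAddCommGroup E] [NormedSpace ℝ E] {θ : A.Par}
    {s : Finset ι} {a : ι → A.Estimate E} (h : ∀ i ∈ s, Sound θ (a i)) :
    Sound θ (∑ i ∈ s, a i) :=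
  Finset.sum_induction a (Sound θ) (fun _ _ => Sound.add) (Sound.zero θ) h

namespace Input

/-- The exact embedding with its Jacobian, as an estimate. -/
def exactEstimate (I : A.Input) (l : ℕ) (v : Fin I.n) : A.Estimate (A.Emb l) :=
  (I.embed l v I.θ, fderiv ℝ (I.embed l v) I.θ, I.embed l v)

/-- The exact embedding and its Jacobian. -/
def exactJet (I : A.Input) (l : ℕ) (v : Fin I.n) : A.Emb l × (A.Par →L[ℝ] A.Emb l) :=
  jet (I.exactEstimate l v)

/-- The message from `u` to `v`, multiplied by the degree of `v`, with its Jacobian. -/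
def messageJet (I : A.Input) (l : ℕ) (v u : Fin I.n) (z w : A.Emb l × (A.Par →L[ℝ] A.Emb l)) :
    A.Agg l × (A.Par →L[ℝ] A.Agg l) :=
  tangent (fun q => (deg I.G v : ℝ) • A.msg I.G l v u q) (msgInput (I.e v u) I.θ z w)

/-- The exact aggregated message with its Jacobian. -/
def aggregateJet (I : A.Input) (l : ℕ) (v : Fin I.n) : A.Agg l × (A.Par →L[ℝ] A.Agg l) :=
  (deg I.G v : ℝ)⁻¹ • ∑ u ∈ neighbors I.G v,
    I.messageJet l v u (I.exactJet l v) (I.exactJet l u)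

theorem sound_exactEstimate {v : Fin I.n} (h : DifferentiableAt ℝ (I.embed l v) I.θ) :
    Sound I.θ (I.exactEstimate l v) := ⟨rfl, h.hasFDerivAt⟩

/-- Exact embeddings are themselves sound estimates, so the chain rule already proved for estimates
gives differentiability and the recursion for the jets. -/
theorem exactJet_succ (hU : Differentiable ℝ (A.upd l))
    (hM : ∀ v, ∀ u ∈ neighbors I.G v, Differentiable ℝ (A.msg I.G l v u))
    (h : ∀ v, DifferentiableAt ℝ (I.embed l v) I.θ) (v : Fin I.n) :
    DifferentiableAt ℝ (I.embed (l + 1) v) I.θ ∧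
      I.exactJet (l + 1) v =
        tangent (A.upd l) (updInput I.θ (I.exactJet l v) (I.aggregateJet l v)) := by
  let s : A.Estimate (A.Agg l) := ∑ u ∈ neighbors I.G v,
    messageEstimate I.θ (I.e v u) (A.msg I.G l v u) (I.exactEstimate l v) (I.exactEstimate l u)
  have hs : Sound I.θ s := Sound.sum fun u hu =>
    (sound_exactEstimate (h v)).messageEstimate (hM v u hu) (sound_exactEstimate (h u))
  have hz := (sound_exactEstimate (h v)).updateEstimate hU hs
  have e : (updateEstimate I.θ (I.exactEstimate l v) s).2.2 = I.embed (l + 1) v := by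
    funext t
    change A.upd l (I.embed l v t, s.2.2 t, t) = _
    simp only [s, Prod.snd_sum, Finset.sum_apply]
    rfl
  have hjet : jet s = I.aggregateJet l v := by
    simp only [s, jet_sum, aggregateJet, messageJet, exactJet, ← smul_jet_messageEstimate,
      ← Finset.smul_sum, smul_smul]
    -- Without neighbors the inverse degree is 0 by convention, but both sums are empty.
    rcases (neighbors I.G v).eq_empty_or_nonempty with hN | hN
    · simp [hN]
    · have : (deg I.G v : ℝ) ≠ 0 := by simpa [deg] using hN.ne_empty
      rw [inv_mul_cancel₀ this, one_smul]
  obtain ⟨h1, h2⟩ := hz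
  rw [e] at h1 h2
  refine ⟨h2.differentiableAt, ?_⟩
  rw [← hjet, exactJet, exactJet, ← jet_updateEstimate]
  exact Prod.ext h1.symm h2.fderiv

/-- The input satisfies the assumptions of the theorem. -/
structure Admissible (I : A.Input) (L : ℕ) (B C₀ : ℝ) (K K' : ℝ → ℝ≥0) : Prop where
  bounded : I.BoundedBy B
  msg : A.LipschitzMsg I.G L K C₀
  jac : A.LipschitzJacMsg I.G L K'

end Input

/-! ### A priori bounds and Lipschitz estimates for jets -/

/-- A bound for `tangent f` on the ball of radius `R`. -/
def growth (K : ℝ → ℝ≥0) (c R : ℝ) : ℝ := c + K R * R + K (R + 1) * R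

/-- A Lipschitz constant for `tangent f` on the ball of radius `R`. -/
def lipBound (K K' : ℝ → ℝ≥0) (R : ℝ) : ℝ := K R + K (R + 1) + K' R * R

/-- A bound for the embeddings of layer `l` and their Jacobians. -/
def radius (A : MPNN) (B C₀ : ℝ) (K : ℝ → ℝ≥0) : ℕ → ℝ
  | 0 => max 1 B
  | l + 1 => max (max (radius A B C₀ K l) (growth K C₀ (radius A B C₀ K l)))
      (growth K ‖A.upd l 0‖ (max (radius A B C₀ K l) (growth K C₀ (radius A B C₀ K l))))

theorem max_one_le_radius (A : MPNN) (B C₀ : ℝ) (K : ℝ → ℝ≥0) (l : ℕ) :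
    max 1 B ≤ A.radius B C₀ K l := by
  induction l with
  | zero => exact le_rfl
  | succ l ih => exact ih.trans ((le_max_left _ _).trans (le_max_left _ _))

theorem lipBound_nonneg {R : ℝ} (hR : 0 ≤ R) : 0 ≤ lipBound K K' R := by
  unfold lipBound; positivity

section Messages

variable {R : ℝ} {v u : Fin I.n} {z w z' w' : A.Emb l × (A.Par →L[ℝ] A.Emb l)}

theorem norm_messageJet_le (hI : I.Admissible L B C₀ K K') (hl : l < L) (hR : max 1 B ≤ R)
    (hu : u ∈ neighbors I.G v) (hz : ‖z‖ ≤ R) (hw : ‖w‖ ≤ R) :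
    ‖I.messageJet l v u z w‖ ≤ growth K C₀ R := by
  obtain ⟨h1, h2⟩ := max_le_iff.1 hR
  exact (hI.msg l hl v u hu).1.norm_tangent_le (hI.msg l hl v u hu).2
    (norm_msgInput_le h1 ((hI.bounded.edge v u hu).trans h2) (hI.bounded.param.trans h2) hz hw)

theorem norm_messageJet_sub_le (hI : I.Admissible L B C₀ K K') (hl : l < L) (hR : max 1 B ≤ R)
    (hu : u ∈ neighbors I.G v) (hz : ‖z‖ ≤ R) (hw : ‖w‖ ≤ R) (hz' : ‖z'‖ ≤ R)
    (hw' : ‖w'‖ ≤ R) :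
    ‖I.messageJet l v u z w - I.messageJet l v u z' w'‖ ≤
      lipBound K K' R * (‖z - z'‖ + ‖w - w'‖) := by
  obtain ⟨h1, h2⟩ := max_le_iff.1 hR
  have he := (hI.bounded.edge v u hu).trans h2
  have hθ := hI.bounded.param.trans h2
  have hJ : LipschitzOnBounded K' (fderiv ℝ fun q => (deg I.G v : ℝ) • A.msg I.G l v u q) := by
    have e : fderiv ℝ (fun q => (deg I.G v : ℝ) • A.msg I.G l v u q) =
        fun q => (deg I.G v : ℝ) • fderiv ℝ (A.msg I.G l v u) q :=
      fderiv_const_smul_field (𝕜 := ℝ) (f := A.msg I.G l v u) (deg I.G v : ℝ)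
    rw [e]
    exact (hI.jac l hl v u hu).2
  refine ((hI.msg l hl v u hu).1.norm_tangent_sub_le hJ (norm_msgInput_le h1 he hθ hz hw)
    (norm_msgInput_le h1 he hθ hz' hw')).trans ?_
  have := lipBound_nonneg (K := K) (K' := K') (R := R) (by linarith)
  exact mul_le_mul_of_nonneg_left (norm_msgInput_sub_le _ _ _ _ _ _) this

end Messages

theorem norm_updateJet_le (hU : A.LipschitzUpd L K) (hl : l < L) {R : ℝ} (hR : 1 ≤ R)
    {θ : A.Par} (hθ : ‖θ‖ ≤ R) {z : A.Emb l × (A.Par →L[ℝ] A.Emb l)}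
    {h : A.Agg l × (A.Par →L[ℝ] A.Agg l)} (hz : ‖z‖ ≤ R) (hh : ‖h‖ ≤ R) :
    ‖tangent (A.upd l) (updInput θ z h)‖ ≤ growth K ‖A.upd l 0‖ R :=
  (hU l hl).norm_tangent_le le_rfl (norm_updInput_le hR hθ hz hh)

theorem norm_updateJet_sub_le (hU : A.LipschitzUpd L K) (hDU : A.LipschitzJacUpd L K')
    (hl : l < L) {R : ℝ} (hR : 1 ≤ R)
    {θ : A.Par} (hθ : ‖θ‖ ≤ R) {z z' : A.Emb l × (A.Par →L[ℝ] A.Emb l)}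
    {h h' : A.Agg l × (A.Par →L[ℝ] A.Agg l)} (hz : ‖z‖ ≤ R) (hh : ‖h‖ ≤ R) (hz' : ‖z'‖ ≤ R)
    (hh' : ‖h'‖ ≤ R) :
    ‖tangent (A.upd l) (updInput θ z h) - tangent (A.upd l) (updInput θ z' h')‖ ≤
      lipBound K K' R * (‖z - z'‖ + ‖h - h'‖) := by
  refine ((hU l hl).norm_tangent_sub_le (hDU l hl).2 (norm_updInput_le hR hθ hz hh)
    (norm_updInput_le hR hθ hz' hh')).trans ?_
  have := lipBound_nonneg (K := K) (K' := K') (R := R) (by linarith)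
  exact mul_le_mul_of_nonneg_left (norm_updInput_sub_le _ _ _ _ _) this

theorem norm_inv_smul_sum_le {V ι : Type*} [NormedAddCommGroup V] [NormedSpace ℝ V]
    {s : Finset ι} (hs : s.Nonempty) {a : ι → V} {c : ℝ} (h : ∀ i ∈ s, ‖a i‖ ≤ c) :
    ‖(s.card : ℝ)⁻¹ • ∑ i ∈ s, a i‖ ≤ c := by
  have hc : 0 < (s.card : ℝ) := by exact_mod_cast hs.card_pos
  rw [norm_smul, norm_inv, Real.norm_natCast, inv_mul_le_iff₀ hc, ← nsmul_eq_mul]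
  exact norm_sum_le_of_le s h |>.trans (by simp)

theorem norm_aggregateJet_le (hI : I.Admissible L B C₀ K K') (hl : l < L) {R : ℝ}
    (hR : max 1 B ≤ R) (h : ∀ v, ‖I.exactJet l v‖ ≤ R) (v : Fin I.n) :
    ‖I.aggregateJet l v‖ ≤ max R (growth K C₀ R) := by
  rcases (neighbors I.G v).eq_empty_or_nonempty with hN | hN
  · simp only [Input.aggregateJet, hN, Finset.sum_empty, smul_zero, norm_zero]
    exact le_max_of_le_left (by linarith [le_max_left 1 B])
  · exact le_max_of_le_right (norm_inv_smul_sum_le hN fun u hu =>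
      norm_messageJet_le hI hl hR hu (h v) (h u))

theorem exactJet_spec (hU : A.LipschitzUpd L K) (hDU : A.LipschitzJacUpd L K')
    (hI : I.Admissible L B C₀ K K') (hl : l ≤ L) (v : Fin I.n) :
    DifferentiableAt ℝ (I.embed l v) I.θ ∧ ‖I.exactJet l v‖ ≤ A.radius B C₀ K l := by
  induction l generalizing v with
  | zero =>
    have e : I.embed 0 v = fun _ => I.x v := rfl
    refine ⟨e ▸ differentiableAt_const _, ?_⟩
    have : I.exactJet 0 v = (I.x v, 0) := by
      simp [Input.exactJet, Input.exactEstimate, jet, e]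
    rw [this]
    exact norm_prod_le_iff.2 ⟨(hI.bounded.feature v).trans (le_max_right _ _), by simp [radius]⟩
  | succ l ih =>
    have hR := A.max_one_le_radius B C₀ K l
    obtain ⟨h1, h2⟩ := Input.exactJet_succ (hDU l hl).1 (fun v u hu => (hI.jac l hl v u hu).1)
      (fun v => (ih (by omega) v).1) v
    refine ⟨h1, ?_⟩
    rw [h2]
    have hR' := hR.trans (le_max_left _ (growth K C₀ (A.radius B C₀ K l)))
    refine (norm_updateJet_le hU hl ((le_max_left _ _).trans hR')
      (hI.bounded.param.trans ((le_max_right _ _).trans hR'))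
      ((ih (by omega) v).2.trans (le_max_left _ _))
      (norm_aggregateJet_le hI hl hR (fun u => (ih (by omega) u).2) v)).trans ?_
    exact le_max_right _ _

/-! ### Soundness of the estimates -/

theorem jet_average {E : Type} [NormedAddCommGroup E] [NormedSpace ℝ E] (d m : ℕ)
    (s : A.Estimate E) :
    jet (((d : ℝ) / (m : ℝ)) • s) = (m : ℝ)⁻¹ • ((d : ℝ) • jet s) := by
  rw [jet_smul, smul_smul, div_eq_inv_mul]

/-- The rescaled sum is a mean of m terms, each of them the degree times a message and hence bounded
whatever the samples are. The maximum with R covers isolated nodes, where the sum is 0. -/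
theorem surely_sumMessages_sound
    (hI : I.Admissible L B C₀ K K') (hl : l < L) {R : ℝ} (hR : max 1 B ≤ R) {m : ℕ} (hm : 1 ≤ m)
    {est : Fin I.n → A.Prog I.n (A.Estimate (A.Emb l))}
    (hest : ∀ u, Prog.Surely I (est u) (fun o => Sound I.θ o.1 ∧ ‖jet o.1‖ ≤ R))
    {v : Fin I.n} {z : A.Estimate (A.Emb l)} (hz : Sound I.θ z ∧ ‖jet z‖ ≤ R) :
    Prog.Surely I (A.sumMessages I.θ l est v z m (deg I.G v)) (fun o =>
      Sound I.θ o.1 ∧ ‖jet (((deg I.G v : ℝ) / (m : ℝ)) • o.1)‖ ≤ max R (growth K C₀ R)) := by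
  have hR0 : 0 ≤ max R (growth K C₀ R) := le_max_of_le_left (by linarith [le_max_left 1 B])
  refine (surely_sumMessages (p := fun o => Sound I.θ o.1 ∧
      ‖(deg I.G v : ℝ) • jet o.1‖ ≤ max R (growth K C₀ R))
    (q := fun n o => Sound I.θ o.1 ∧
      ‖(deg I.G v : ℝ) • jet o.1‖ ≤ n * max R (growth K C₀ R)) (fun u hu => ?_)
    (fun n => ⟨Sound.zero _, ?_⟩) (fun n s a hs ha => ⟨hs.1.add ha.1, ?_⟩) m).mono fun o ho =>
      ⟨ho.1, ?_⟩
  · refine (hest u).mono fun o ho => ⟨hz.1.messageEstimate (hI.jac l hl v u hu).1 ho.1, ?_⟩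
    rw [smul_jet_messageEstimate]
    exact le_max_of_le_right (norm_messageJet_le hI hl hR hu hz.2 ho.2)
  · simp only [jet_zero, smul_zero, norm_zero]
    positivity
  · rw [jet_add, smul_add, Nat.cast_succ, add_one_mul]
    exact norm_add_le_of_le hs.2 ha.2
  · rw [jet_average, norm_smul, norm_inv, Real.norm_natCast,
      inv_mul_le_iff₀ (by exact_mod_cast hm)]
    exact ho.2

theorem surely_neighborSampling_sound (hU : A.LipschitzUpd L K) (hDU : A.LipschitzJacUpd L K')
    (hI : I.Admissible L B C₀ K K') {m : ℕ} (hm : 1 ≤ m) (hl : l ≤ L) (v : Fin I.n) :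
    Prog.Surely I (A.neighborSampling (fun _ => m) I.θ l v)
      (fun o => Sound I.θ o.1 ∧ ‖jet o.1‖ ≤ A.radius B C₀ K l) := by
  induction l generalizing v with
  | zero =>
    rw [surely_neighborSampling_zero]
    exact ⟨⟨rfl, hasFDerivAt_const _ _⟩, norm_prod_le_iff.2
      ⟨(hI.bounded.feature v).trans (le_max_right _ _), norm_zero.trans_le (by simp [radius])⟩⟩
  | succ l ih =>
    have hR := A.max_one_le_radius B C₀ K l
    have hR' := hR.trans (le_max_left _ (growth K C₀ (A.radius B C₀ K l)))
    rw [surely_neighborSampling_succ]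
    refine (ih (by omega) v).mono fun z hz => ?_
    refine (surely_sumMessages_sound hI hl hR hm (ih (by omega)) hz).mono fun s hs => ?_
    refine ⟨hz.1.updateEstimate (hDU l hl).1 (hs.1.smul _), ?_⟩
    rw [jet_updateEstimate]
    exact (norm_updateJet_le hU hl ((le_max_left _ _).trans hR')
      (hI.bounded.param.trans ((le_max_right _ _).trans hR')) (hz.2.trans (le_max_left _ _))
      hs.2).trans (le_max_right _ _)

end MPNN

namespace MPNN

variable {A : MPNN} {I : A.Input} {L l : ℕ} {B C₀ : ℝ} {K K' : ℝ → ℝ≥0}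

/-! ### Concentration -/

/-- If the values of finitely many functionals control the norm, then bounds for the exponential
moments of these functionals at a random vector give a bound for the exponential moments of the norm
of the mean of independent copies. -/
theorem avg_exp_norm_sum_le {α V : Type} [AddMonoid α] [NormedAddCommGroup V] [NormedSpace ℝ V]
    {S : Finset (V →L[ℝ] ℝ)} (hS : ∀ v, ∃ φ ∈ S, ‖v‖ ≤ φ v) (J : α →+ V) (H : V)
    (P : A.Prog I.n α) {m : ℕ} (hm : 1 ≤ m) {t ρ : ℝ} (ht : 0 ≤ t)
    (hP : ∀ φ ∈ S, Prog.avg I P (fun a => Real.exp (t / m * φ (J a - H))) ≤ ρ) :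
    Prog.avg I (Prog.sum P m) (fun s => Real.exp (t * ‖(m : ℝ)⁻¹ • J s - H‖)) ≤
      S.card * ρ ^ m := by
  have hm0 : (m : ℝ) ≠ 0 := by positivity
  -- The centering at H is spread evenly over the m summands, so by independence the moment of the
  -- mean is the m-th power of the moment of one centered sample.
  have key : ∀ φ ∈ S, Prog.avg I (Prog.sum P m)
      (fun s => Real.exp (t * φ ((m : ℝ)⁻¹ • J s - H))) ≤ ρ ^ m := by
    intro φ hφ
    have e1 : (fun s => Real.exp (t * φ ((m : ℝ)⁻¹ • J s - H))) =
        fun s => Real.exp (-(t / m * φ H)) ^ m * Real.exp (t / m * φ (J s)) := by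
      funext s
      rw [← Real.exp_nat_mul, ← Real.exp_add]
      congr 1
      simp only [map_sub, map_smul, smul_eq_mul]
      field_simp
      ring
    have e2 : (fun a => Real.exp (t / m * φ (J a - H))) =
        fun a => Real.exp (-(t / m * φ H)) * Real.exp (t / m * φ (J a)) := by
      funext a
      rw [← Real.exp_add]
      congr 1
      simp only [map_sub]
      ring
    have h := hP φ hφ
    rw [e2, Prog.avg_const_mul] at h
    rw [e1, Prog.avg_const_mul, Prog.avg_sum_of_mul P (by simp)
      (fun a b => by rw [map_add, map_add, mul_add, Real.exp_add]), ← mul_pow]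
    exact pow_le_pow_left₀
      (mul_nonneg (Real.exp_nonneg _) (Prog.avg_nonneg fun _ => Real.exp_nonneg _)) h m
  calc _ ≤ Prog.avg I (Prog.sum P m)
        (fun s => ∑ φ ∈ S, Real.exp (t * φ ((m : ℝ)⁻¹ • J s - H))) := by
        refine Prog.avg_mono_of_le fun s => ?_
        obtain ⟨φ, hφ, h⟩ := hS ((m : ℝ)⁻¹ • J s - H)
        -- The exponential at the dominating functional is one term of the sum over S; this costs
        -- the factor `S.card`.
        refine le_trans ?_ (Finset.single_le_sum (fun _ _ => Real.exp_nonneg _) hφ)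
        gcongr
    _ ≤ ∑ φ ∈ S, ρ ^ m := by
        rw [Prog.avg_finset_sum]
        exact Finset.sum_le_sum key
    _ = S.card * ρ ^ m := by simp

section Step

variable {R κ : ℝ} {est : Fin I.n → A.Prog I.n (A.Estimate (A.Emb l))} {v : Fin I.n}
  {z : A.Estimate (A.Emb l)}

/-- The three factors are the error of z, which all samples share, the error of the neighbor's fresh
estimate, and the random choice of the neighbor. The last one is a Hoeffding factor, since the exact
messages M u are bounded and their mean is H. -/
theorem avg_exp_sampleMessage_le (hI : I.Admissible L B C₀ K K') (hl : l < L)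
    (hR : max 1 B ≤ R) (hexact : ∀ u, ‖I.exactJet l u‖ ≤ R)
    (hest : ∀ u, Prog.Surely I (est u) (fun o => ‖jet o.1‖ ≤ R)) (hz : ‖jet z‖ ≤ R)
    {φ : A.Agg l × (A.Par →L[ℝ] A.Agg l) →L[ℝ] ℝ} (hφ : ‖φ‖ ≤ κ) {s g : ℝ} (hs : 0 ≤ s)
    (hg : ∀ u, Prog.avg I (est u)
      (fun o => Real.exp (s * κ * lipBound K K' R * ‖jet o - I.exactJet l u‖)) ≤ g)
    {N : ℕ} (hN : deg I.G v = N + 1) :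
    Prog.avg I (A.sampleMessage I.θ l est v z N) (fun a =>
        Real.exp (s * φ ((deg I.G v : ℝ) • jet a - I.aggregateJet l v))) ≤
      Real.exp (s * κ * lipBound K K' R * ‖jet z - I.exactJet l v‖) * g *
        Real.exp (2 * (s * κ * growth K C₀ R) ^ 2) := by
  have hκ : 0 ≤ κ := φ.opNorm_nonneg.trans hφ
  have hd : 0 < (deg I.G v : ℝ) := by rw [hN]; positivity
  have hne : (neighbors I.G v).Nonempty := Finset.card_pos.1 (by exact_mod_cast hd)
  set H := I.aggregateJet l v with hH
  set M : Fin I.n → A.Agg l × (A.Par →L[ℝ] A.Agg l) := fun u =>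
    I.messageJet l v u (I.exactJet l v) (I.exactJet l u) with hM
  have hMn : ∀ u ∈ neighbors I.G v, ‖M u‖ ≤ growth K C₀ R := fun u hu =>
    norm_messageJet_le hI hl hR hu (hexact v) (hexact u)
  have hHn : ‖H‖ ≤ growth K C₀ R := norm_inv_smul_sum_le hne hMn
  have hφle : ∀ x, |φ x| ≤ κ * ‖x‖ := fun x => (φ.le_opNorm x).trans (by gcongr)
  have hstep : ∀ u ∈ neighbors I.G v, Prog.avg I (est u) (fun w =>
      Real.exp (s * φ ((deg I.G v : ℝ) •
        jet (messageEstimate I.θ (I.e v u) (A.msg I.G l v u) z w) - H))) ≤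
      Real.exp (s * φ (M u - H)) *
        (Real.exp (s * κ * lipBound K K' R * ‖jet z - I.exactJet l v‖) * g) := by
    intro u hu
    rw [← mul_assoc, ← Real.exp_add]
    refine le_trans ?_ (mul_le_mul_of_nonneg_left (hg u) (Real.exp_nonneg _))
    rw [← Prog.avg_const_mul]
    refine Prog.avg_mono ((hest u).mono fun o ho => ?_)
    rw [← Real.exp_add]
    refine Real.exp_le_exp.2 ?_
    have h1 := norm_messageJet_sub_le hI hl hR hu hz ho (hexact v) (hexact u)
    have h2 := (le_abs_self _).trans (hφle (I.messageJet l v u (jet z) (jet o.1) - M u))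
    rw [smul_jet_messageEstimate]
    change s * φ (I.messageJet l v u (jet z) (jet o.1) - H) ≤ _
    have e : φ (I.messageJet l v u (jet z) (jet o.1) - H) =
        φ (M u - H) + φ (I.messageJet l v u (jet z) (jet o.1) - M u) := by
      simp only [map_sub]; ring
    rw [e]
    have h3 : s * φ (I.messageJet l v u (jet z) (jet o.1) - M u) ≤
        s * (κ * (lipBound K K' R *
          (‖jet z - I.exactJet l v‖ + ‖jet o.1 - I.exactJet l u‖))) := by
      gcongr
      exact h2.trans (by gcongr)
    linarith
  -- The exponents sum to 0 because H is the mean of the M u. They are at most b = 2 s κ `growth K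
  -- C₀ R` in absolute value, and b² / 2 is the exponent on the right.
  have hsum : ∑ u ∈ neighbors I.G v, Real.exp (s * φ (M u - H)) ≤
      (deg I.G v : ℝ) * Real.exp (2 * (s * κ * growth K C₀ R) ^ 2) := by
    have := sum_exp_le_of_sum_eq_zero (neighbors I.G v) (fun u => s * φ (M u - H))
      (b := 2 * (s * κ * growth K C₀ R)) (fun u hu => ?_) ?_
    · rwa [show (2 * (s * κ * growth K C₀ R)) ^ 2 / 2 = 2 * (s * κ * growth K C₀ R) ^ 2 by ring]
        at this
    · rw [abs_mul, abs_of_nonneg hs]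
      have h1 := hφle (M u - H)
      have h2 : ‖M u - H‖ ≤ growth K C₀ R + growth K C₀ R := norm_sub_le_of_le (hMn u hu) hHn
      calc s * |φ (M u - H)| ≤ s * (κ * (growth K C₀ R + growth K C₀ R)) := by
            gcongr
            exact h1.trans (by gcongr)
        _ = _ := by ring
    · rw [← Finset.mul_sum, ← map_sum, Finset.sum_sub_distrib, Finset.sum_const, hH,
        Input.aggregateJet, ← Nat.cast_smul_eq_nsmul ℝ]
      change s * φ (∑ u ∈ neighbors I.G v, M u -
        (deg I.G v : ℝ) • (deg I.G v : ℝ)⁻¹ • ∑ u ∈ neighbors I.G v, M u) = 0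
      rw [smul_inv_smul₀ hd.ne', sub_self, map_zero, mul_zero]
  rw [avg_sampleMessage _ _ _ _ hN, div_le_iff₀ hd]
  have hg0 : 0 ≤ g := (Prog.avg_nonneg fun _ => Real.exp_nonneg _).trans (hg v)
  calc _ ≤ ∑ u ∈ neighbors I.G v, Real.exp (s * φ (M u - H)) *
        (Real.exp (s * κ * lipBound K K' R * ‖jet z - I.exactJet l v‖) * g) :=
        Finset.sum_le_sum hstep
    _ ≤ (deg I.G v : ℝ) * Real.exp (2 * (s * κ * growth K C₀ R) ^ 2) *
        (Real.exp (s * κ * lipBound K K' R * ‖jet z - I.exactJet l v‖) * g) := by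
        rw [← Finset.sum_mul]
        gcongr
    _ = _ := by ring

/-- G appears to the first power although m neighbors are estimated: each sample has weight t / m,
so by Jensen it contributes at most the m-th root of G. -/
theorem avg_exp_sumMessages_le (hI : I.Admissible L B C₀ K K') (hl : l < L)
    (hR : max 1 B ≤ R) (hexact : ∀ u, ‖I.exactJet l u‖ ≤ R)
    (hest : ∀ u, Prog.Surely I (est u) (fun o => ‖jet o.1‖ ≤ R)) (hz : ‖jet z‖ ≤ R)
    {S : Finset (A.Agg l × (A.Par →L[ℝ] A.Agg l) →L[ℝ] ℝ)}
    (hS : ∀ v, ∃ φ ∈ S, ‖v‖ ≤ φ v) (hκ : ∀ φ ∈ S, ‖φ‖ ≤ κ) {m : ℕ} (hm : 1 ≤ m) {t G : ℝ}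
    (ht : 0 ≤ t) (hG : ∀ u, Prog.avg I (est u)
      (fun o => Real.exp (t * κ * lipBound K K' R * ‖jet o - I.exactJet l u‖)) ≤ G) :
    Prog.avg I (A.sumMessages I.θ l est v z m (deg I.G v)) (fun s =>
        Real.exp (t * ‖jet (((deg I.G v : ℝ) / (m : ℝ)) • s) - I.aggregateJet l v‖)) ≤
      S.card * (Real.exp (t * κ * lipBound K K' R * ‖jet z - I.exactJet l v‖) * G *
        Real.exp (2 * (t * κ * growth K C₀ R) ^ 2 / m)) := by
  obtain ⟨φ₀, hφ₀, -⟩ := hS 0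
  have hκ0 : 0 ≤ κ := φ₀.opNorm_nonneg.trans (hκ φ₀ hφ₀)
  have hΛ : 0 ≤ lipBound K K' R := lipBound_nonneg (by linarith [le_max_left 1 B])
  have hm0 : (0 : ℝ) < m := by exact_mod_cast hm
  -- For an isolated node the left-hand side is 1, so every factor on the right has to be at least
  -- 1.
  have hG1 : 1 ≤ G := by
    refine le_trans ?_ (hG v)
    conv_lhs => rw [← Prog.avg_const (I := I) (est v) 1]
    exact Prog.avg_mono_of_le fun o => Real.one_le_exp (by positivity)
  rcases hd : deg I.G v with _ | N
  · have hN : neighbors I.G v = ∅ := Finset.card_eq_zero.1 hd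
    have hH : I.aggregateJet l v = 0 := by simp [Input.aggregateJet, hN]
    rw [hH]
    have h1 : (1 : ℝ) ≤ S.card := by exact_mod_cast Finset.card_pos.2 ⟨φ₀, hφ₀⟩
    have h2 : Real.exp (t * ‖jet ((((0 : ℕ) : ℝ) / (m : ℝ)) • (0 : A.Estimate (A.Agg l))) - 0‖)
        = 1 := by simp [jet_zero]
    refine (h2.le : _).trans ?_
    refine one_le_mul_of_one_le_of_one_le h1 (one_le_mul_of_one_le_of_one_le
      (one_le_mul_of_one_le_of_one_le ?_ hG1) ?_) <;>
    exact Real.one_le_exp (by positivity)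
  · have hJ := avg_exp_norm_sum_le hS (I := I)
      (J := ⟨⟨fun a : A.Estimate (A.Agg l) => (deg I.G v : ℝ) • jet a, by simp [jet_zero]⟩,
        fun a b => by simp [jet_add]⟩) (I.aggregateJet l v)
      (A.sampleMessage I.θ l est v z N) hm ht
      (ρ := Real.exp (t / m * κ * lipBound K K' R * ‖jet z - I.exactJet l v‖) *
        G ^ (m : ℝ)⁻¹ * Real.exp (2 * (t / m * κ * growth K C₀ R) ^ 2)) fun φ hφ => ?_
    · simp only [AddMonoidHom.coe_mk, ZeroHom.coe_mk, ← jet_average, hd] at hJ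
      refine hJ.trans (le_of_eq ?_)
      have e1 : (m : ℝ) * (t / m * κ * lipBound K K' R * ‖jet z - I.exactJet l v‖) =
          t * κ * lipBound K K' R * ‖jet z - I.exactJet l v‖ := by field_simp
      have e2 : (m : ℝ) * (2 * (t / m * κ * growth K C₀ R) ^ 2) =
          2 * (t * κ * growth K C₀ R) ^ 2 / m := by field_simp
      rw [mul_pow, mul_pow, ← Real.exp_nat_mul, ← Real.exp_nat_mul,
        Real.rpow_inv_natCast_pow (by linarith) (by omega), e1, e2]
    · refine avg_exp_sampleMessage_le hI hl hR hexact hest hz (hκ φ hφ) (by positivity)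
        (fun u => ?_) hd
      rw [Real.le_rpow_inv_iff_of_pos (Prog.avg_nonneg fun _ => Real.exp_nonneg _)
        (by linarith) hm0, Real.rpow_natCast]
      refine (Prog.avg_pow_le (fun _ => Real.exp_nonneg _) m).trans ((hG u).trans' ?_)
      refine Prog.avg_mono_of_le fun o => le_of_eq ?_
      rw [← Real.exp_nat_mul]
      congr 1
      field_simp

end Step

/-- The error of the estimates has sub-Gaussian exponential moments. -/
theorem exists_avg_exp_error_le (hU : A.LipschitzUpd L K) (hDU : A.LipschitzJacUpd L K')
    (B C₀ : ℝ) (hl : l ≤ L) :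
    ∃ a c : ℝ, 1 ≤ a ∧ 0 ≤ c ∧ ∀ I : A.Input, I.Admissible L B C₀ K K' → ∀ v : Fin I.n,
      ∀ m : ℕ, 1 ≤ m → ∀ t : ℝ, 0 ≤ t →
        Prog.avg I (A.neighborSampling (fun _ => m) I.θ l v)
          (fun o => Real.exp (t * ‖jet o - I.exactJet l v‖)) ≤ a * Real.exp (c * t ^ 2 / m) := by
  induction l with
  | zero =>
    refine ⟨1, 0, le_rfl, le_rfl, fun I hI v m hm t ht => ?_⟩
    rw [avg_neighborSampling_zero]
    have e : I.embed 0 v = fun _ => I.x v := rfl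
    have : I.exactJet 0 v = (I.x v, 0) := by
      simp [Input.exactJet, Input.exactEstimate, jet, e]
    rw [this]
    simp [jet]
  | succ l ih =>
    obtain ⟨a, c, ha, hc, h⟩ := ih (by omega)
    obtain ⟨S, hS⟩ := exists_finset_norm_le_apply (A.Agg l × (A.Par →L[ℝ] A.Agg l))
    obtain ⟨κ, hκ⟩ : ∃ κ, ∀ φ ∈ S, ‖φ‖ ≤ κ :=
      ⟨∑ φ ∈ S, ‖φ‖, fun φ hφ => Finset.single_le_sum (f := fun φ => ‖φ‖)
        (fun φ _ => φ.opNorm_nonneg) hφ⟩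
    obtain ⟨φ₀, hφ₀, -⟩ := hS 0
    have hκ0 : 0 ≤ κ := φ₀.opNorm_nonneg.trans (hκ φ₀ hφ₀)
    set R := A.radius B C₀ K l
    have hR : max 1 B ≤ R := A.max_one_le_radius B C₀ K l
    set R' := max R (growth K C₀ R)
    have hR' : max 1 B ≤ R' := hR.trans (le_max_left _ _)
    set Λ := lipBound K K' R
    set Λ' := lipBound K K' R'
    have hΛ : 0 ≤ Λ := lipBound_nonneg (by linarith [le_max_left 1 B])
    have hΛ' : 0 ≤ Λ' := lipBound_nonneg (by linarith [le_max_left 1 B])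
    have hS1 : (1 : ℝ) ≤ S.card := by exact_mod_cast Finset.card_pos.2 ⟨φ₀, hφ₀⟩
    -- The exponents come from the neighbors' estimates, the choice of neighbors and the node's own
    -- previous estimate. The induction hypothesis enters for the first and the last of them, hence
    -- a twice.
    refine ⟨S.card * a * a, c * (Λ' * κ * Λ) ^ 2 + 2 * (Λ' * κ * growth K C₀ R) ^ 2 +
      c * (Λ' + Λ' * κ * Λ) ^ 2, ?_, by positivity, fun I hI v m hm t ht => ?_⟩
    · exact one_le_mul_of_one_le_of_one_le (one_le_mul_of_one_le_of_one_le hS1 ha) ha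
    have hexact : ∀ u, ‖I.exactJet l u‖ ≤ R := fun u => (exactJet_spec hU hDU hI (by omega) u).2
    have hsound := surely_neighborSampling_sound hU hDU hI hm (l := l) (by omega)
    have hH := norm_aggregateJet_le hI hl hR hexact v
    have hupd := (Input.exactJet_succ (hDU l hl).1 (fun v u hu => (hI.jac l hl v u hu).1)
      (fun v => (exactJet_spec hU hDU hI (by omega) v).1) v).2
    rw [avg_neighborSampling_succ]
    set G := a * Real.exp (c * (t * Λ' * κ * Λ) ^ 2 / m)
    have hstep : ∀ z : A.Estimate (A.Emb l), Sound I.θ z ∧ ‖jet z‖ ≤ R →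
        Prog.avg I (A.sumMessages I.θ l (A.neighborSampling (fun _ => m) I.θ l) v z m
          (deg I.G v)) (fun s => Real.exp (t * ‖jet (updateEstimate I.θ z
            (((deg I.G v : ℝ) / (m : ℝ)) • s)) - I.exactJet (l + 1) v‖)) ≤
        S.card * G * Real.exp (2 * (t * Λ' * κ * growth K C₀ R) ^ 2 / m) *
          Real.exp (t * (Λ' + Λ' * κ * Λ) * ‖jet z - I.exactJet l v‖) := by
      intro z hz
      have hagg := avg_exp_sumMessages_le hI hl hR hexact
        (fun u => (hsound u).mono fun o ho => ho.2) (v := v) hz.2 hS hκ hm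
        (t := t * Λ') (G := G) (by positivity) (fun u => h I hI u m hm _ (by positivity))
      calc _ ≤ Prog.avg I (A.sumMessages I.θ l (A.neighborSampling (fun _ => m) I.θ l) v z m
              (deg I.G v)) (fun s => Real.exp (t * Λ' * ‖jet z - I.exactJet l v‖) *
              Real.exp (t * Λ' * ‖jet (((deg I.G v : ℝ) / (m : ℝ)) • s) -
                I.aggregateJet l v‖)) := by
            refine Prog.avg_mono
              ((surely_sumMessages_sound hI hl hR hm hsound hz).mono fun s hs => ?_)
            rw [← Real.exp_add, ← mul_add, jet_updateEstimate, hupd, mul_assoc]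
            gcongr
            exact norm_updateJet_sub_le hU hDU hl ((le_max_left _ _).trans hR')
              (hI.bounded.param.trans ((le_max_right _ _).trans hR'))
              (hz.2.trans (le_max_left _ _)) hs.2 ((hexact v).trans (le_max_left _ _)) hH
        _ ≤ Real.exp (t * Λ' * ‖jet z - I.exactJet l v‖) *
            (S.card * (Real.exp (t * Λ' * κ * Λ * ‖jet z - I.exactJet l v‖) * G *
              Real.exp (2 * (t * Λ' * κ * growth K C₀ R) ^ 2 / m))) := by
            rw [Prog.avg_const_mul]
            gcongr
        _ = _ := by
            -- The error of z enters twice: directly through the update function, and through every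
            -- sampled message.
            rw [show t * (Λ' + Λ' * κ * Λ) * ‖jet z - I.exactJet l v‖ =
              t * Λ' * ‖jet z - I.exactJet l v‖ + t * Λ' * κ * Λ * ‖jet z - I.exactJet l v‖ by
                ring, Real.exp_add]
            ring
    calc _ ≤ Prog.avg I (A.neighborSampling (fun _ => m) I.θ l v) (fun z =>
          S.card * G * Real.exp (2 * (t * Λ' * κ * growth K C₀ R) ^ 2 / m) *
          Real.exp (t * (Λ' + Λ' * κ * Λ) * ‖jet z - I.exactJet l v‖)) :=
          Prog.avg_mono ((hsound v).mono fun z hz => hstep z.1 hz)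
      _ ≤ S.card * G * Real.exp (2 * (t * Λ' * κ * growth K C₀ R) ^ 2 / m) *
          (a * Real.exp (c * (t * (Λ' + Λ' * κ * Λ)) ^ 2 / m)) := by
          rw [Prog.avg_const_mul]
          gcongr
          exact h I hI v m hm _ (by positivity)
      _ = S.card * a * a * (Real.exp (c * (t * Λ' * κ * Λ) ^ 2 / m) *
          Real.exp (2 * (t * Λ' * κ * growth K C₀ R) ^ 2 / m) *
          Real.exp (c * (t * (Λ' + Λ' * κ * Λ)) ^ 2 / m)) := by
          simp only [G]
          ring
      _ = _ := by
          rw [← Real.exp_add, ← Real.exp_add]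
          congr 2
          ring

end MPNN

/-! ### Sample size and tail bound -/

namespace MPNN

variable {A : MPNN} {L : ℕ} {B C₀ : ℝ} {K K' : ℝ → ℝ≥0}

/-- The number of samples per layer, chosen for the tail bound `a * exp (-m * ε ^ 2 / Q)`. -/
def sampleSize (a Q ε δ : ℝ) : ℕ := ⌈Q / ε ^ 2 * (Real.log a + Real.log (1 / δ))⌉₊ + 1

theorem exp_neg_sampleSize_le {a Q ε δ : ℝ} (ha : 1 ≤ a) (hQ : 0 < Q) (hε : 0 < ε) (hδ : 0 < δ) :
    a * Real.exp (-(sampleSize a Q ε δ * ε ^ 2 / Q)) ≤ δ := by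
  have h1 : Q / ε ^ 2 * (Real.log a + Real.log (1 / δ)) ≤ sampleSize a Q ε δ := by
    refine (Nat.le_ceil _).trans ?_
    rw [sampleSize]
    push_cast
    linarith
  have h2 : Real.log a + Real.log (1 / δ) ≤ sampleSize a Q ε δ * ε ^ 2 / Q := by
    rw [le_div_iff₀ hQ]
    calc _ = Q / ε ^ 2 * (Real.log a + Real.log (1 / δ)) * ε ^ 2 := by field_simp
      _ ≤ _ := by gcongr
  calc a * Real.exp (-(sampleSize a Q ε δ * ε ^ 2 / Q))
      ≤ a * Real.exp (-(Real.log a + Real.log (1 / δ))) := by gcongr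
    _ = δ := by
      rw [neg_add, Real.exp_add, one_div, Real.log_inv, neg_neg, Real.exp_neg, Real.exp_log hδ,
        Real.exp_log (by linarith), mul_inv_cancel_left₀ (by linarith)]

/-- The terms log a and 2 (rounding up and the extra sample) are absorbed because log(1/δ) ≥
log(1/δ₀) > 0 and 1 / ε² ≥ 1. -/
theorem sampleSize_le {a Q δ₀ ε δ : ℝ} (ha : 1 ≤ a) (hQ : 0 < Q) (hδ₀ : δ₀ < 1) (hε : 0 < ε)
    (hε1 : ε < 1) (hδ : 0 < δ) (hδδ₀ : δ ≤ δ₀) :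
    (sampleSize a Q ε δ : ℝ) ≤
      (Q * (Real.log a / Real.log (1 / δ₀) + 1) + 2 / Real.log (1 / δ₀)) *
        (1 / ε ^ 2 * Real.log (1 / δ)) := by
  have hδ₀' : 0 < δ₀ := hδ.trans_le hδδ₀
  have hl0 : 0 < Real.log (1 / δ₀) := Real.log_pos (by rw [one_div]; exact one_lt_inv₀ hδ₀' |>.2 hδ₀)
  have hl : Real.log (1 / δ₀) ≤ Real.log (1 / δ) :=
    Real.log_le_log (by positivity) (one_div_le_one_div_of_le hδ hδδ₀)
  have hla : 0 ≤ Real.log a := Real.log_nonneg ha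
  have he : 1 ≤ 1 / ε ^ 2 := by
    rw [le_div_iff₀ (by positivity), one_mul]
    exact pow_le_one₀ hε.le hε1.le
  set y := Real.log (1 / δ)
  set y₀ := Real.log (1 / δ₀)
  have hr : 1 ≤ y / y₀ := (one_le_div hl0).2 hl
  have h1 : (sampleSize a Q ε δ : ℝ) ≤ Q / ε ^ 2 * (Real.log a + y) + 2 := by
    have := Nat.ceil_lt_add_one (a := Q / ε ^ 2 * (Real.log a + y))
      (mul_nonneg (by positivity) (by linarith))
    rw [sampleSize]
    push_cast
    linarith
  have h2 : Real.log a ≤ Real.log a * (y / y₀) := le_mul_of_one_le_right hla hr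
  have h3 : 1 ≤ 1 / ε ^ 2 * (y / y₀) := one_le_mul_of_one_le_of_one_le he hr
  calc _ ≤ Q / ε ^ 2 * (Real.log a * (y / y₀) + y) + 2 * (1 / ε ^ 2 * (y / y₀)) := by
        refine h1.trans (add_le_add ?_ (by linarith))
        gcongr
    _ = _ := by field_simp

theorem norm_snd_jet_sub_le (I : A.Input) (v : Fin I.n) (o : A.Estimate (A.Emb L)) :
    ‖o.2.1 - fderiv ℝ (I.embed L v) I.θ‖ ≤ ‖jet o - I.exactJet L v‖ :=
  norm_snd_le (jet o - I.exactJet L v)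

/-- The gradient estimate has sub-Gaussian tails. -/
theorem exists_gradient_tail_le (hU : A.LipschitzUpd L K) (hDU : A.LipschitzJacUpd L K')
    (B C₀ : ℝ) :
    ∃ a Q : ℝ, 1 ≤ a ∧ 0 < Q ∧ ∀ I : A.Input, I.Admissible L B C₀ K K' → ∀ v : Fin I.n,
      ∀ m : ℕ, 1 ≤ m → ∀ ε : ℝ, 0 < ε →
        ((A.neighborSampling (fun _ => m) I.θ L v).run I).toOuterMeasure
          {o | ε ≤ frobeniusNorm (o.1.2.1 - fderiv ℝ (I.embed L v) I.θ)} ≤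
            ENNReal.ofReal (a * Real.exp (-(m * ε ^ 2 / Q))) := by
  obtain ⟨a, c, ha, hc, h⟩ := exists_avg_exp_error_le hU hDU B C₀ le_rfl
  set q : ℝ := A.p + 1 with hq
  have hq0 : 0 < q := by positivity
  refine ⟨a, 4 * (c + 1) * q ^ 2, ha, by positivity, fun I hI v m hm ε hε => ?_⟩
  -- This t minimizes (c + 1) t² / m - t ε / q, with minimum -m ε² / (4 (c + 1) q²). Using c + 1
  -- instead of c avoids division by 0.
  set t : ℝ := m * ε / (2 * (c + 1) * q) with ht
  have hm0 : (0 : ℝ) < m := by exact_mod_cast hm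
  have ht0 : 0 ≤ t := by positivity
  refine (Prog.toOuterMeasure_run_le _
    (f := fun o => Real.exp (-(t * (ε / q))) * Real.exp (t * ‖jet o - I.exactJet L v‖))
    (fun _ => by positivity) fun o ho => ?_).trans (ENNReal.ofReal_le_ofReal ?_)
  · rw [← Real.exp_add]
    refine Real.one_le_exp ?_
    have h1 : ε ≤ q * ‖jet o.1 - I.exactJet L v‖ :=
      (le_trans ho (frobeniusNorm_le _)).trans (by gcongr; exact norm_snd_jet_sub_le I v o.1)
    have h2 : ε / q ≤ ‖jet o.1 - I.exactJet L v‖ := (div_le_iff₀' hq0).2 h1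
    nlinarith
  · rw [Prog.avg_const_mul]
    calc _ ≤ Real.exp (-(t * (ε / q))) * (a * Real.exp (c * t ^ 2 / m)) := by
          gcongr
          exact h I hI v m hm t ht0
      _ = a * Real.exp (c * t ^ 2 / m - t * (ε / q)) := by
          rw [sub_eq_neg_add, Real.exp_add]
          ring
      _ ≤ a * Real.exp ((c + 1) * t ^ 2 / m - t * (ε / q)) := by
          gcongr
          linarith
      _ = _ := by
          congr 2
          rw [ht]
          field_simp
          ring

end MPNN

end

theorem theorem5 (A : MPNN) (L : ℕ) (hL : 1 ≤ L) (B C₀ : ℝ) (K K' : ℝ → ℝ≥0)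
    (hU : A.LipschitzUpd L K) (hDU : A.LipschitzJacUpd L K') :
    ∃ r : ℝ → ℝ → ℕ → ℕ,
      -- the sample sizes suffice
      (∀ ε δ : ℝ, 0 < ε → 0 < δ → δ < 1 →
        (∀ l, 1 ≤ l → l ≤ L → 1 ≤ r ε δ l) ∧
        ∀ I : A.Input, I.BoundedBy B → A.LipschitzMsg I.G L K C₀ → A.LipschitzJacMsg I.G L K' →
          ∀ v : Fin I.n,
            DifferentiableAt ℝ (I.embed L v) I.θ ∧
            (∀ o ∈ ((A.neighborSampling (r ε δ) I.θ L v).run I).support,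
              o.1.1 = o.1.2.2 I.θ ∧ HasFDerivAt o.1.2.2 o.1.2.1 I.θ) ∧
            ((A.neighborSampling (r ε δ) I.θ L v).run I).toOuterMeasure
              {o | ε ≤ frobeniusNorm (o.1.2.1 - fderiv ℝ (I.embed L v) I.θ)} ≤
                ENNReal.ofReal δ) ∧
      -- sample sizes and running time
      (∀ ε₀ δ₀ : ℝ, 0 < ε₀ → ε₀ < 1 → 0 < δ₀ → δ₀ < 1 → ∃ C : ℝ,
        ∀ ε δ : ℝ, 0 < ε → ε ≤ ε₀ → 0 < δ → δ ≤ δ₀ →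
          (r ε δ L : ℝ) ≤ C * (1 / ε ^ 2 * Real.log (1 / δ)) ∧
          (∀ l, 1 ≤ l → l < L →
            (r ε δ l : ℝ) ≤ C * (1 / ε ^ 2 * (Real.log (1 / ε) + Real.log (1 / δ)))) ∧
          ∀ I : A.Input, ∀ v : Fin I.n,
            ∀ o ∈ ((A.neighborSampling (r ε δ) I.θ L v).run I).support,
              (o.2 : ℝ) ≤ C * (1 / ε ^ (2 * L) *
                (Real.log (1 / ε) + Real.log (1 / δ)) ^ (L - 1) * Real.log (1 / δ))) := by
  obtain ⟨a, Q, ha, hQ, htail⟩ := MPNN.exists_gradient_tail_le hU hDU B C₀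
  -- The same sample size serves all layers.
  refine ⟨fun ε δ _ => MPNN.sampleSize a Q ε δ, fun ε δ hε hδ hδ1 => ⟨fun l _ _ => ?_, ?_⟩, ?_⟩
  · exact Nat.le_add_left 1 _
  · intro I hB hM hJ v
    have hI : I.Admissible L B C₀ K K' := ⟨hB, hM, hJ⟩
    have hm : 1 ≤ MPNN.sampleSize a Q ε δ := Nat.le_add_left 1 _
    refine ⟨(MPNN.exactJet_spec hU hDU hI le_rfl v).1, fun o ho => ?_, ?_⟩
    · exact (MPNN.surely_neighborSampling_sound hU hDU hI hm le_rfl v o ho).1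
    · exact (htail I hI v _ hm ε hε).trans
        (ENNReal.ofReal_le_ofReal (MPNN.exp_neg_sampleSize_le ha hQ hε hδ))
  · intro ε₀ δ₀ _ hε₀1 hδ₀ hδ₀1
    set C : ℝ := Q * (Real.log a / Real.log (1 / δ₀) + 1) + 2 / Real.log (1 / δ₀) with hC
    have hl0 : 0 < Real.log (1 / δ₀) :=
      Real.log_pos (by rw [one_div]; exact (one_lt_inv₀ hδ₀).2 hδ₀1)
    have hla : 0 ≤ Real.log a := Real.log_nonneg ha
    have hC0 : 0 ≤ C := by positivity
    -- The first summand serves the sample sizes, the second the running time (20 m)^L.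
    refine ⟨C + (20 * C) ^ L, fun ε δ hε hεε₀ hδ hδδ₀ => ?_⟩
    have hε1 : ε < 1 := hεε₀.trans_lt hε₀1
    have hm := MPNN.sampleSize_le ha hQ hδ₀1 hε hε1 hδ hδδ₀
    rw [← hC] at hm
    have hx : 0 ≤ Real.log (1 / ε) :=
      Real.log_nonneg (by rw [one_div]; exact (one_le_inv₀ hε).2 hε1.le)
    have hy : 0 ≤ Real.log (1 / δ) :=
      Real.log_nonneg (by rw [one_div]; exact (one_le_inv₀ hδ).2 (hδδ₀.trans hδ₀1.le))
    have hCC : C ≤ C + (20 * C) ^ L := by linarith [pow_nonneg (by positivity : 0 ≤ 20 * C) L]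
    refine ⟨hm.trans (by gcongr), fun l _ _ => hm.trans ?_, fun I v o ho => ?_⟩
    · gcongr
      linarith
    · have h1 : (o.2 : ℝ) ≤ (20 * MPNN.sampleSize a Q ε δ) ^ L := by
        exact_mod_cast MPNN.time_neighborSampling (Nat.le_add_left 1 _) I.θ L v o ho
      calc (o.2 : ℝ) ≤ (20 * (C * (1 / ε ^ 2 * Real.log (1 / δ)))) ^ L :=
            h1.trans (by gcongr)
        _ = (20 * C) ^ L * (1 / ε ^ (2 * L) * Real.log (1 / δ) ^ (L - 1) * Real.log (1 / δ)) := by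
            rw [mul_assoc (1 / ε ^ (2 * L)), ← pow_succ, Nat.sub_add_cancel hL, pow_mul,
              ← one_div_pow (ε ^ 2) L, ← mul_pow, ← mul_pow, mul_assoc]
        -- The time bound without log(1/ε) is weakened to the stated form; ε < 1 makes this
        -- logarithm nonnegative.
        _ ≤ _ := by
            gcongr
            · linarith
            · linarith
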